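/- Lattice paths are finite, lie in the first quadrant, start on the $y$-axis and end on the $x$-axis, and use the unit steps $NE:(x,y)\to(x+1,y+1)$, $SE:(x,y)\to(x+1,y-1)$ and $E:(x,0)\to(x+1,0)$ (so $E$ steps occur only along the $x$-axis); either the path has no steps or its last step is $SE$. A peak is a vertex preceded by an $NE$ step and followed by an $SE$ step; the height of a vertex is its $y$-coordinate, its weight is its $x$-coordinate, and the major index of a path is the sum of the weights of its peaks. The relative height of a peak $(x,y)$ is the largest integer $h$ for which there are two vertices $(x',y-h)$ and $(x'',y-h)$ on the path with $x'<x<x''$ such that between these two vertices there are no peaks of height greater than $y$ and every peak of height $y$ has abscissa at least $x$. For integers $k\ge a\ge 1$ and $n\ge 0$, let $S_{k,a}(n)$ denote the number of lattice paths of major index $n$ that start at $(0,k+1-a)$, have height at most $k$ throughout, and satisfy: (i) for every peak of relative height $k$ or $k-1$, the number of $E$ steps between the starting point and that peak is a multiple of $4$; (ii) every peak of weight $x$ and relative height $r$ satisfies $x\equiv r\pmod 2$. Theorem. Let $k\ge a\ge 1$ with $k\not\equiv a\pmod 2$. Then every $S_{k,a}(n)$ is finite and, as formal power series in $q$, $$\sum_{n=0}^{\infty}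 S_{k,a}(n)\,q^{n}=\sum_{n_1,n_2,\ldots,n_{k-1}\ge 0}\frac{q^{N_1^2+N_2^2+\cdots+N_{k-1}^2+2N_a+2N_{a+2}+\cdots+2N_{k-1}}\,(-q;q^2)_{n_{k-1}}}{(q^2;q^2)_{n_1}(q^2;q^2)_{n_2}\cdots(q^2;q^2)_{n_{k-2}}\,(q^4;q^4)_{n_{k-1}}},$$ where $N_j=n_j+n_{j+1}+\cdots+n_{k-1}$ and $(b;t)_m=\prod_{j=0}^{m-1}(1-bt^j)$. -/

import Mathlib

open scoped PowerSeries PowerSeries.WithPiTopology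

/-- The three unit steps. -/
inductive PathStep : Type where
  | NE : PathStep
  | SE : PathStep
  | E : PathStep
  deriving DecidableEq

namespace PathStep

/-- The change of the `y`-coordinate along a step. Every step increases the `x`-coordinate by `1`. -/
def rise : PathStep → ℤ
  | NE => 1
  | SE => -1
  | E => 0

end PathStep

namespace LatticePath

/-- The `y`-coordinate of the vertex with `x`-coordinate `i` on the path that starts at `(0, s)` and
has the list of steps `L`. Since every step increases `x` by `1`, the vertices of the path are exactly
the points `(i, height s L i)` with `0 ≤ i ≤ L.length`. -/
def height (s : ℕ) (L : List PathStep) (i : ℕ) : ℤ :=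
  (s : ℤ) + ((L.take i).map PathStep.rise).sum

/-- The steps `L`, started at `(0, s)`, form a lattice path: it stays in the first quadrant, ends on
the `x`-axis, has `E` steps only along the `x`-axis, and is empty or ends with an `SE` step. -/
structure IsLatticePath (s : ℕ) (L : List PathStep) : Prop where
  nonneg : ∀ i ≤ L.length, 0 ≤ height s L i
  ends_on_axis : height s L L.length = 0
  east_on_axis : ∀ i, L[i]? = some PathStep.E → height s L i = 0
  last_step : L = [] ∨ L.getLast? = some PathStep.SE

/-- The vertex with `x`-coordinate (weight) `x` is a peak: it is preceded by an `NE` step and followed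
by an `SE` step. -/
def IsPeak (L : List PathStep) (x : ℕ) : Prop :=
  1 ≤ x ∧ L[x - 1]? = some PathStep.NE ∧ L[x]? = some PathStep.SE

instance (L : List PathStep) (x : ℕ) : Decidable (IsPeak L x) :=
  inferInstanceAs (Decidable (_ ∧ _ ∧ _))

/-- The major index: the sum of the weights of the peaks. -/
def majorIndex (L : List PathStep) : ℕ :=
  ∑ x ∈ Finset.range L.length with IsPeak L x, x

/-- `r` is the relative height of the peak `(x, y)`: the largest integer `h` for which there are two
vertices `(x', y - h)` and `(x'', y - h)` on the path with `x' < x < x''`, such that between them there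
are no peaks of height greater than `y`, and every peak of height `y` has abscissa at least `x`. -/
def IsRelativeHeight (s : ℕ) (L : List PathStep) (x : ℕ) (r : ℤ) : Prop :=
  IsGreatest {h : ℤ | ∃ x' x'' : ℕ, x' < x ∧ x < x'' ∧ x'' ≤ L.length ∧
    height s L x' = height s L x - h ∧ height s L x'' = height s L x - h ∧
    ∀ z, x' < z → z < x'' → IsPeak L z →
      height s L z ≤ height s L x ∧ (height s L z = height s L x → x ≤ z)} r

/-- The number of `E` steps between the starting point and the vertex with `x`-coordinate `x`. -/
def eastStepsBefore (L : List PathStep) (x : ℕ) : ℕ :=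
  (L.take x).count PathStep.E

/-- The set of lattice paths counted by `S_{k,a}(n)`. -/
def admissiblePaths (k a n : ℕ) : Set (List PathStep) :=
  {L | IsLatticePath (k + 1 - a) L ∧
    (∀ i ≤ L.length, height (k + 1 - a) L i ≤ k) ∧
    (∀ (x : ℕ) (r : ℤ), IsPeak L x → IsRelativeHeight (k + 1 - a) L x r →
      (r = k ∨ r = (k : ℤ) - 1) → 4 ∣ eastStepsBefore L x) ∧
    (∀ (x : ℕ) (r : ℤ), IsPeak L x → IsRelativeHeight (k + 1 - a) L x r →
      (x : ℤ) ≡ r [ZMOD 2]) ∧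
    majorIndex L = n}

/-- `S_{k,a}(n)`. -/
noncomputable def numPaths (k a n : ℕ) : ℕ :=
  (admissiblePaths k a n).ncard

end LatticePath

namespace Multisum

/-- The finite `q`-Pochhammer symbol `(b; t)_n = (1 - b)(1 - b t) ⋯ (1 - b t ^ (n - 1))`. -/
noncomputable def qPoch (b t : ℤ⟦X⟧) (n : ℕ) : ℤ⟦X⟧ :=
  ∏ j ∈ Finset.range n, (1 - b * t ^ j)

/-- The summation variable `n_j`, `1 ≤ j ≤ k - 1`, of a tuple `(n_1, …, n_{k-1})` indexed from `0`. -/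
def part (k : ℕ) (n : Fin (k - 1) → ℕ) (j : ℕ) : ℕ :=
  if h : 1 ≤ j ∧ j ≤ k - 1 then n ⟨j - 1, by omega⟩ else 0

/-- `N_j = n_j + n_{j+1} + ⋯ + n_{k-1}`, i.e. `N_k = 0` and `n_j = N_j - N_{j+1}`. -/
def partialSum (k : ℕ) (n : Fin (k - 1) → ℕ) (j : ℕ) : ℕ :=
  ∑ i ∈ Finset.Icc j (k - 1), part k n i

/-- `N_1² + ⋯ + N_{k-1}² + 2 N_a + 2 N_{a+2} + ⋯ + 2 N_{k-1}` (for `a ≢ k` mod `2`). -/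
def expo (k a : ℕ) (n : Fin (k - 1) → ℕ) : ℕ :=
  ∑ j ∈ Finset.Icc 1 (k - 1), partialSum k n j ^ 2 +
    ∑ j ∈ Finset.Icc a (k - 1) with j ≡ a [MOD 2], 2 * partialSum k n j

/-- `(q²; q²)_{n_1} ⋯ (q²; q²)_{n_{k-2}} (q⁴; q⁴)_{n_{k-1}}`, a power series with constant term `1`. -/
noncomputable def denominator (k : ℕ) (n : Fin (k - 1) → ℕ) : ℤ⟦X⟧ :=
  (∏ j ∈ Finset.Icc 1 (k - 2),
    qPoch ((PowerSeries.X : ℤ⟦X⟧) ^ 2) ((PowerSeries.X : ℤ⟦X⟧) ^ 2) (part k n j)) *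
  qPoch ((PowerSeries.X : ℤ⟦X⟧) ^ 4) ((PowerSeries.X : ℤ⟦X⟧) ^ 4) (part k n (k - 1))

/-- The summand of the multisum, a formal power series in `q = X`. As the denominator has constant
term `1`, `PowerSeries.invOfUnit _ 1` is its multiplicative inverse. -/
noncomputable def summand (k a : ℕ) (n : Fin (k - 1) → ℕ) : ℤ⟦X⟧ :=
  (PowerSeries.X : ℤ⟦X⟧) ^ expo k a n *
    qPoch (-(PowerSeries.X : ℤ⟦X⟧)) ((PowerSeries.X : ℤ⟦X⟧) ^ 2) (part k n (k - 1)) *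
    PowerSeries.invOfUnit (denominator k n) 1

end Multisum

/-!
The conditions on relative heights are equivalent to purely local ones
(`LatticePath.IsLatticePath.hasEvenValleys_iff`). Since the starting height is even, the parity
condition says that the level from which the relative height of a peak is measured has the parity of
the number of `E` steps before the peak. The leftmost highest peak of an excursion from the axis is
measured from the axis, so peaks occur only after an even number of `E` steps; every valley above the
axis is the base of some peak, so all valleys have even height; and the condition modulo `4` says that
after `2` modulo `4` many `E` steps the height is at most `k - 2`.

Such a path decomposes into pairs of steps `NE NE`, `NE SE`, `SE SE`, `E E` between vertices of even
height. Let `A_J(z)` be the generating function of the paths that start at height `2 J` with `z` marking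
the number of peaks; moving a path to the right by `2` is the substitution `η : z ↦ q² z`. A path that
starts at height `2 j` after `2` modulo `4` many `E` steps has the same generating function as one that
starts at height `2 j + 2` with no `E` step before, so a pair `E E` acts like a step of the index `J`
between `0` and `1`. Eliminating the paths that begin with `NE NE` gives
`η (A_{J+1} + A_{J-1}) = A_J + (1 - q² z) η² A_J - q z η A_J`, with `A_{-1} = A_1`, and a boundary
relation at the largest `J`, which depends on the parity of `k`. These relations determine the `A_J`,
since `η` pushes everything but the constant term to higher powers of `q`
(`LatticePath.hasCard_runs`).

The multisum, with `z` marking `N_1`, satisfies the same relations (`Multisum.series_relations`), by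
induction on `k`: the multisum for `(k + 1, a + 1)` arises from that for `(k, a)` by multiplication with
`1 / (z; q²)_∞` followed by `z^M ↦ q^(M²) z^M`, and this transformation preserves the three-term
relation and exchanges the two kinds of boundary relations.
-/

/-! ### Reciprocals of `q`-Pochhammer symbols -/

namespace Multisum

open PowerSeries Finset

theorem eq_invOfUnit_of_mul_eq_one {φ ψ : ℤ⟦X⟧} (hφ : constantCoeff φ = 1) (h : φ * ψ = 1) :
    ψ = invOfUnit φ 1 := by
  have h1 : φ * invOfUnit φ 1 = 1 := mul_invOfUnit φ 1 (by simpa using hφ)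
  calc ψ = ψ * (φ * invOfUnit φ 1) := by rw [h1, mul_one]
    _ = (φ * ψ) * invOfUnit φ 1 := by ring
    _ = invOfUnit φ 1 := by rw [h, one_mul]

theorem invOfUnit_mul_invOfUnit {φ ψ : ℤ⟦X⟧} (hφ : constantCoeff φ = 1)
    (hψ : constantCoeff ψ = 1) :
    invOfUnit (φ * ψ) 1 = invOfUnit φ 1 * invOfUnit ψ 1 := by
  symm
  apply eq_invOfUnit_of_mul_eq_one (by simp [hφ, hψ])
  have h1 : φ * invOfUnit φ 1 = 1 := mul_invOfUnit φ 1 (by simpa using hφ)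
  have h2 : ψ * invOfUnit ψ 1 = 1 := mul_invOfUnit ψ 1 (by simpa using hψ)
  calc φ * ψ * (invOfUnit φ 1 * invOfUnit ψ 1)
      = (φ * invOfUnit φ 1) * (ψ * invOfUnit ψ 1) := by ring
    _ = 1 := by rw [h1, h2, one_mul]

theorem constantCoeff_qPoch {b t : ℤ⟦X⟧} (hb : constantCoeff b = 0) (n : ℕ) :
    constantCoeff (qPoch b t n) = 1 := by
  simp [qPoch, map_prod, hb]

theorem qPoch_succ (b t : ℤ⟦X⟧) (n : ℕ) :
    qPoch b t (n + 1) = qPoch b t n * (1 - b * t ^ n) := by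
  simp [qPoch, prod_range_succ]

/-- The reciprocal `1 / (b; t)_n` of a `q`-Pochhammer symbol with constant term `1`. -/
noncomputable def qPochInv (b t : ℤ⟦X⟧) (n : ℕ) : ℤ⟦X⟧ :=
  invOfUnit (qPoch b t n) 1

theorem qPochInv_succ {b : ℤ⟦X⟧} (hb : constantCoeff b = 0) (t : ℤ⟦X⟧) (n : ℕ) :
    (1 - b * t ^ n) * qPochInv b t (n + 1) = qPochInv b t n := by
  apply eq_invOfUnit_of_mul_eq_one (constantCoeff_qPoch hb n)
  have := mul_invOfUnit (qPoch b t (n + 1)) 1 (by simp [constantCoeff_qPoch hb])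
  rw [qPoch_succ] at this
  rw [qPochInv, qPoch_succ, ← mul_assoc, this]

/-! ### A transformation of series in two variables -/

/-- The substitution `z ↦ q² z` on power series in `z` with coefficients in `ℤ⟦q⟧`. -/
noncomputable def shift : ℤ⟦X⟧⟦X⟧ →+* ℤ⟦X⟧⟦X⟧ :=
  rescale ((X : ℤ⟦X⟧) ^ 2)

theorem coeff_shift (f : ℤ⟦X⟧⟦X⟧) (n : ℕ) :
    coeff n (shift f) = ((X : ℤ⟦X⟧) ^ 2) ^ n * coeff n f :=
  coeff_rescale f _ n

theorem shift_X : shift X = C ((X : ℤ⟦X⟧) ^ 2) * X := by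
  ext1 n
  rw [coeff_shift, coeff_C_mul]
  by_cases h : n = 1
  · simp [h]
  · simp [coeff_X, h]

/-- The linear map `z ^ n ↦ q ^ (n²) z ^ n`. -/
noncomputable def gauss : ℤ⟦X⟧⟦X⟧ →ₗ[ℤ⟦X⟧] ℤ⟦X⟧⟦X⟧ where
  toFun f := PowerSeries.mk fun n => (X : ℤ⟦X⟧) ^ (n ^ 2) * coeff n f
  map_add' f g := by ext1 n; simp [mul_add]
  map_smul' c f := by ext1 n; simp [mul_left_comm]

theorem coeff_gauss (f : ℤ⟦X⟧⟦X⟧) (n : ℕ) :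
    coeff n (gauss f) = (X : ℤ⟦X⟧) ^ (n ^ 2) * coeff n f := by
  simp [gauss]

theorem gauss_shift (f : ℤ⟦X⟧⟦X⟧) : gauss (shift f) = shift (gauss f) := by
  ext1 n
  simp only [coeff_gauss, coeff_shift]
  ring

theorem gauss_C_mul (c : ℤ⟦X⟧) (f : ℤ⟦X⟧⟦X⟧) : gauss (C c * f) = C c * gauss f := by
  ext1 n
  simp only [coeff_gauss, coeff_C_mul]
  ring

theorem gauss_X_mul (f : ℤ⟦X⟧⟦X⟧) :
    gauss (X * f) = C (X : ℤ⟦X⟧) * (X * shift (gauss f)) := by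
  ext1 n
  cases n with
  | zero => simp [coeff_gauss]
  | succ n =>
    simp only [coeff_gauss, coeff_C_mul, coeff_succ_X_mul, coeff_shift]
    ring

/-- The series `∑ zⁿ / (q²; q²)_n = 1 / (z; q²)_∞`. -/
noncomputable def qExp : ℤ⟦X⟧⟦X⟧ :=
  PowerSeries.mk fun n => qPochInv (X ^ 2) (X ^ 2) n

theorem shift_qExp : shift qExp = (1 - X) * qExp := by
  ext1 n
  rw [coeff_shift, sub_mul, one_mul, map_sub]
  cases n with
  | zero => simp [qExp]
  | succ n =>
    rw [coeff_succ_X_mul]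
    simp only [qExp, coeff_mk]
    rw [← qPochInv_succ (b := X ^ 2) (by simp) (X ^ 2) n]
    ring

/-- The transformation `∑ f_N z^N ↦ ∑ z^M q^(M²) ∑_{N ≤ M} f_N / (q²; q²)_{M - N}`. It adds one
summation variable to the multisum. -/
noncomputable def bailey (f : ℤ⟦X⟧⟦X⟧) : ℤ⟦X⟧⟦X⟧ :=
  gauss (qExp * f)

theorem shift_mul_qExp (f : ℤ⟦X⟧⟦X⟧) :
    shift (qExp * f) = (1 - X) * (qExp * shift f) := by
  rw [map_mul, shift_qExp, mul_assoc]

theorem shift_shift_mul_qExp (f : ℤ⟦X⟧⟦X⟧) :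
    shift (shift (qExp * f)) =
      (1 - C ((X : ℤ⟦X⟧) ^ 2) * X) * ((1 - X) * (qExp * shift (shift f))) := by
  rw [shift_mul_qExp, map_mul, shift_mul_qExp, map_sub, map_one, shift_X]

/-- The `q`-difference equation relating the generating function `f` of the paths that start at some
even height to the sum `g` of those for the two neighbouring even heights. -/
def ThreeTerm (f g : ℤ⟦X⟧⟦X⟧) : Prop :=
  shift g = f + (1 - C ((X : ℤ⟦X⟧) ^ 2) * X) * shift (shift f) - C (X : ℤ⟦X⟧) * X * shift f

theorem bailey_three_term {f g : ℤ⟦X⟧⟦X⟧} (h : ThreeTerm f g) :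
    ThreeTerm (bailey f) (bailey g) := by
  unfold ThreeTerm at h ⊢
  have h1 : shift (qExp * g) = qExp * f - X * (qExp * f) + shift (shift (qExp * f))
      - C (X : ℤ⟦X⟧) * (X * shift (qExp * f)) := by
    rw [shift_mul_qExp, shift_shift_mul_qExp, shift_mul_qExp, h]
    ring
  have h2 := congrArg gauss h1
  simp only [map_sub, map_add, gauss_shift, gauss_X_mul, gauss_C_mul] at h2
  simp only [bailey]
  rw [h2, map_pow]
  ring

/-- `bailey` turns the boundary relation for even maximal height into that for odd maximal height. -/
theorem bailey_top_even {f g : ℤ⟦X⟧⟦X⟧} (h : f = shift g) :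
    bailey f = C (X : ℤ⟦X⟧) * X * shift (bailey f) + shift (bailey g) := by
  have h1 : shift (qExp * g) = qExp * f - X * (qExp * f) := by
    rw [shift_mul_qExp, h]
    ring
  have h2 := congrArg gauss h1
  simp only [map_sub, gauss_shift, gauss_X_mul] at h2
  simp only [bailey]
  rw [h2]
  ring

/-- `bailey` turns the boundary relation for odd maximal height into a three-term relation involving
`shift (bailey f)`, the series of the new highest starting point. -/
theorem bailey_top_odd {f g : ℤ⟦X⟧⟦X⟧}
    (h : f = C (X : ℤ⟦X⟧) * X * shift f + shift g) :
    ThreeTerm (bailey f) (shift (bailey f) + bailey g) := by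
  unfold ThreeTerm
  have h0 : shift g = f - C (X : ℤ⟦X⟧) * X * shift f := by
    nth_rewrite 1 [h]
    ring
  have h1 : shift (qExp * g) = qExp * f - X * (qExp * f)
      - C (X : ℤ⟦X⟧) * (X * shift (qExp * f)) := by
    rw [shift_mul_qExp, shift_mul_qExp, h0]
    ring
  have h2 := congrArg gauss h1
  simp only [map_sub, gauss_shift, gauss_X_mul, gauss_C_mul] at h2
  simp only [bailey, map_add]
  rw [h2, map_pow]
  ring

/-! ### The multisum as a series in two variables -/

/-- The multisum with an additional variable `z` marking `N_1`, i.e. the series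
`∑_M z^M ∑_{N_1 = M} summand k a n`. -/
noncomputable def series (k a : ℕ) : ℤ⟦X⟧⟦X⟧ :=
  PowerSeries.mk fun M => ∑ n ∈ Finset.Nat.antidiagonalTuple (k - 1) M, summand k a n

theorem coeff_series (k a M : ℕ) :
    coeff M (series (k + 1) a) =
      ∑ n ∈ Finset.Nat.antidiagonalTuple k M, summand (k + 1) a (n : Fin k → ℕ) := by
  rw [series, coeff_mk]
  rfl

theorem sum_antidiagonalTuple_succ {β : Type*} [AddCommMonoid β] (k M : ℕ)
    (f : (Fin (k + 1) → ℕ) → β) :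
    ∑ n ∈ Finset.Nat.antidiagonalTuple (k + 1) M, f n =
      ∑ p ∈ antidiagonal M, ∑ t ∈ Finset.Nat.antidiagonalTuple k p.2, f (Fin.cons p.1 t) := by
  rw [sum_sigma']
  symm
  refine sum_nbij' (fun x => Fin.cons x.1.1 x.2)
    (fun n => ⟨(n 0, ∑ i, Fin.tail n i), Fin.tail n⟩) ?_ ?_ ?_ ?_ ?_
  · rintro ⟨⟨i, j⟩, t⟩ h
    simp only [mem_sigma, HasAntidiagonal.mem_antidiagonal, Finset.Nat.mem_antidiagonalTuple] at h
    simp [Finset.Nat.mem_antidiagonalTuple, Fin.sum_univ_succ, h.1, h.2]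
  · intro n h
    rw [Finset.Nat.mem_antidiagonalTuple, Fin.sum_univ_succ] at h
    simpa [Finset.Nat.mem_antidiagonalTuple, Fin.tail] using h
  · rintro ⟨⟨i, j⟩, t⟩ h
    simp only [mem_sigma, HasAntidiagonal.mem_antidiagonal, Finset.Nat.mem_antidiagonalTuple] at h
    obtain ⟨-, rfl⟩ := h
    simp
  · intro n _
    simp
  · intro x _
    rfl

theorem part_cons_one (k i : ℕ) (t : Fin k → ℕ) :
    part (k + 2) (Fin.cons i t : Fin (k + 1) → ℕ) 1 = i := by
  simp [part]

theorem part_cons_succ (k i j : ℕ) (t : Fin k → ℕ) (hj : 1 ≤ j) :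
    part (k + 2) (Fin.cons i t : Fin (k + 1) → ℕ) (j + 1) = part (k + 1) t j := by
  unfold part
  by_cases h : j ≤ k
  · rw [dif_pos (by omega), dif_pos (by omega)]
    obtain ⟨j, rfl⟩ : ∃ j', j = j' + 1 := ⟨j - 1, by omega⟩
    exact Fin.cons_succ (α := fun _ => ℕ) i t ⟨j, by omega⟩
  · rw [dif_neg (by omega), dif_neg (by omega)]

@[to_additive sum_Icc_add_one]
theorem prod_Icc_add_one {β : Type*} [CommMonoid β] (f : ℕ → β) (a b : ℕ) :
    ∏ j ∈ Icc (a + 1) (b + 1), f j = ∏ j ∈ Icc a b, f (j + 1) := by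
  rw [← Finset.map_add_right_Icc, prod_map]
  rfl

@[to_additive sum_Icc_one_eq_add]
theorem prod_Icc_one_eq_mul {β : Type*} [CommMonoid β] (f : ℕ → β) (b : ℕ) :
    ∏ j ∈ Icc 1 (b + 1), f j = f 1 * ∏ j ∈ Icc 1 b, f (j + 1) := by
  rw [← prod_Icc_add_one f 1 b]
  exact (Finset.mul_prod_Ioc_eq_prod_Icc (f := f) (show 1 ≤ b + 1 by omega)).symm

theorem partialSum_cons_succ (k i j : ℕ) (t : Fin k → ℕ) (hj : 1 ≤ j) :
    partialSum (k + 2) (Fin.cons i t : Fin (k + 1) → ℕ) (j + 1) = partialSum (k + 1) t j := by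
  unfold partialSum
  rw [show k + 2 - 1 = k + 1 from rfl, sum_Icc_add_one, show k + 1 - 1 = k from rfl]
  refine sum_congr rfl fun l hl => part_cons_succ k i l t ?_
  rw [mem_Icc] at hl
  omega

theorem partialSum_one (k : ℕ) (n : Fin k → ℕ) : partialSum (k + 1) n 1 = ∑ i, n i := by
  have h : ∀ i : Fin k, n i = part (k + 1) n (i + 1) := fun i => by
    rw [part, dif_pos (by omega)]
    rfl
  simp_rw [h]
  rw [← Finset.sum_range fun i => part (k + 1) n (i + 1), partialSum,
    show Icc 1 (k + 1 - 1) = Ico 1 (k + 1) from rfl, sum_Ico_eq_sum_range]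
  exact sum_congr rfl fun i _ => congrArg (part (k + 1) n) (add_comm 1 i)

theorem expo_cons (k a i : ℕ) (t : Fin k → ℕ) (ha : 1 ≤ a) :
    expo (k + 2) (a + 1) (Fin.cons i t : Fin (k + 1) → ℕ) =
      (i + ∑ l, t l) ^ 2 + expo (k + 1) a t := by
  unfold expo
  rw [show k + 2 - 1 = k + 1 from rfl, show k + 1 - 1 = k from rfl, sum_Icc_one_eq_add,
    sum_filter, sum_filter, sum_Icc_add_one, partialSum_one (k + 1), Fin.sum_univ_succ,
    Fin.cons_zero, add_assoc]
  simp only [Fin.cons_succ]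
  congr 2
  · refine sum_congr rfl fun j hj => ?_
    rw [mem_Icc] at hj
    rw [partialSum_cons_succ _ _ _ _ hj.1]
  · refine sum_congr rfl fun j hj => ?_
    rw [mem_Icc] at hj
    rw [partialSum_cons_succ _ _ _ _ (ha.trans hj.1)]
    simp only [Nat.ModEq]
    congr 1
    simp only [eq_iff_iff]
    omega

theorem denominator_cons (k i : ℕ) (t : Fin (k + 1) → ℕ) :
    denominator (k + 3) (Fin.cons i t : Fin (k + 2) → ℕ) =
      qPoch (X ^ 2) (X ^ 2) i * denominator (k + 2) t := by
  unfold denominator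
  rw [show k + 3 - 2 = k + 1 from rfl, show k + 2 - 2 = k from rfl,
    show k + 3 - 1 = (k + 1) + 1 from rfl, show k + 2 - 1 = k + 1 from rfl,
    part_cons_succ _ _ _ _ (by omega), ← mul_assoc]
  congr 1
  have h := prod_Icc_one_eq_mul (fun j => qPoch ((X : ℤ⟦X⟧) ^ 2) (X ^ 2)
    (part (k + 3) (Fin.cons i t : Fin (k + 2) → ℕ) j)) k
  rw [h, part_cons_one]
  congr 1
  refine prod_congr rfl fun j hj => ?_
  rw [mem_Icc] at hj
  rw [part_cons_succ _ _ _ _ hj.1]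

theorem constantCoeff_denominator (k : ℕ) (n : Fin (k - 1) → ℕ) :
    constantCoeff (denominator k n) = 1 := by
  unfold denominator
  rw [map_mul, map_prod, constantCoeff_qPoch (by simp), mul_one]
  exact prod_eq_one fun j _ => constantCoeff_qPoch (by simp) _

theorem summand_cons (k a i : ℕ) (t : Fin (k + 1) → ℕ) (ha : 1 ≤ a) :
    summand (k + 3) (a + 1) (Fin.cons i t : Fin (k + 2) → ℕ) =
      X ^ (i + ∑ l, t l) ^ 2 * (qPochInv (X ^ 2) (X ^ 2) i * summand (k + 2) a t) := by
  unfold summand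
  rw [expo_cons _ _ _ _ ha, denominator_cons,
    invOfUnit_mul_invOfUnit (constantCoeff_qPoch (by simp) _) (constantCoeff_denominator _ _),
    show k + 3 - 1 = (k + 1) + 1 from rfl, show k + 2 - 1 = k + 1 from rfl,
    part_cons_succ _ _ _ _ (by omega), pow_add, qPochInv]
  ring

/-- Raising `k` and `a` by one amounts to applying `bailey`: on the path side, to a volcanic uplift
followed by the insertion of peaks of relative height one. -/
theorem series_succ (k a : ℕ) (ha : 1 ≤ a) :
    series (k + 3) (a + 1) = bailey (series (k + 2) a) := by
  ext1 M
  rw [bailey, coeff_gauss, coeff_mul, coeff_series, sum_antidiagonalTuple_succ, mul_sum]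
  refine sum_congr rfl fun p hp => ?_
  rw [HasAntidiagonal.mem_antidiagonal] at hp
  rw [qExp, coeff_mk, coeff_series, mul_sum, mul_sum]
  refine sum_congr rfl fun t ht => ?_
  rw [Finset.Nat.mem_antidiagonalTuple] at ht
  rw [summand_cons _ _ _ _ ha, ht, hp]

theorem expo_one (k : ℕ) (hk : Even k) (n : Fin (k + 1) → ℕ) :
    expo (k + 2) 1 n = expo (k + 2) 3 n + 2 * ∑ i, n i := by
  unfold expo
  rw [show k + 2 - 1 = k + 1 from rfl, add_assoc, ← partialSum_one (k + 1)]
  congr 1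
  rw [sum_filter, sum_filter, sum_Icc_one_eq_add]
  rw [if_pos (Nat.ModEq.refl 1), add_comm]
  congr 1
  cases k with
  | zero => rfl
  | succ k =>
    rw [sum_Icc_one_eq_add, if_neg (by decide), zero_add, sum_Icc_add_one, sum_Icc_add_one]
    rfl

theorem series_one (k : ℕ) (hk : Even k) : series (k + 2) 1 = shift (series (k + 2) 3) := by
  ext1 M
  rw [coeff_shift, coeff_series, coeff_series, mul_sum]
  refine sum_congr rfl fun n hn => ?_
  rw [Finset.Nat.mem_antidiagonalTuple] at hn
  unfold summand
  rw [expo_one k hk, hn, pow_add, ← pow_mul]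
  ring

theorem coeff_series_two (M : ℕ) :
    coeff M (series 2 3) =
      X ^ (M ^ 2) * qPoch (-X) (X ^ 2) M * qPochInv (X ^ 4) (X ^ 4) M := by
  rw [coeff_series, Finset.Nat.antidiagonalTuple_one, sum_singleton]
  have hp : part 2 (![M] : Fin 1 → ℕ) 1 = M := by simp [part]
  simp [summand, expo, denominator, partialSum, hp, qPochInv]

theorem series_two_three_term :
    ThreeTerm (series 2 3) (shift (series 2 3) + shift (series 2 3)) := by
  unfold ThreeTerm
  ext1 M
  rw [sub_mul, one_mul, mul_assoc, mul_assoc]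
  simp only [map_add, map_sub, coeff_shift, coeff_C_mul]
  cases M with
  | zero => simp
  | succ M =>
    simp only [coeff_succ_X_mul, coeff_shift, coeff_series_two]
    rw [qPoch_succ, ← qPochInv_succ (b := X ^ 4) (by simp) (X ^ 4) M]
    ring

theorem bailey_add (f g : ℤ⟦X⟧⟦X⟧) : bailey (f + g) = bailey f + bailey g := by
  simp [bailey, mul_add]

/-- The relations between the series `series k a` for fixed `k`: a reflected three-term relation at
`a = k + 1`, the three-term relation in between, and the boundary relation for odd `k`. -/
theorem series_relations (t : ℕ) :
    ThreeTerm (series (t + 2) (t + 3)) (series (t + 2) (t + 1) + series (t + 2) (t + 1)) ∧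
    (∀ a, 1 ≤ a → a + 3 ≤ t + 2 → a % 2 ≠ t % 2 →
      ThreeTerm (series (t + 2) (a + 2)) (series (t + 2) a + series (t + 2) (a + 4))) ∧
    (t % 2 = 1 → series (t + 2) 2 =
      C (X : ℤ⟦X⟧) * X * shift (series (t + 2) 2) + shift (series (t + 2) 4)) := by
  induction t with
  | zero =>
    refine ⟨?_, fun a _ _ => by omega, fun h => by omega⟩
    rw [series_one 0 (by decide)]
    exact series_two_three_term
  | succ t ih =>
    obtain ⟨h1, h2, h3⟩ := ih
    refine ⟨?_, ?_, ?_⟩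
    · have := bailey_three_term h1
      rw [bailey_add, ← series_succ t (t + 3) (by omega), ← series_succ t (t + 1) (by omega)] at this
      exact this
    · intro a ha hat hpar
      obtain rfl | ⟨b, rfl, hb⟩ : a = 1 ∨ ∃ b, a = b + 1 ∧ 1 ≤ b := by
        rcases Nat.lt_or_ge 1 a with h | h
        · exact Or.inr ⟨a - 1, by omega, by omega⟩
        · exact Or.inl (by omega)
      · have := bailey_top_odd (h3 (by omega))
        rw [← series_succ t 2 (by omega), ← series_succ t 4 (by omega)] at this
        rw [series_one (t + 1) (Nat.even_iff.2 (by omega))]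
        exact this
      · have := bailey_three_term (h2 b hb (by omega) (by omega))
        rw [bailey_add, ← series_succ t (b + 2) (by omega), ← series_succ t b hb,
          ← series_succ t (b + 4) (by omega)] at this
        exact this
    · intro ht
      have := bailey_top_even (series_one t (Nat.even_iff.2 (by omega)))
      rw [← series_succ t 1 le_rfl, ← series_succ t 3 (by omega)] at this
      exact this

/-- The series that turns out to be the generating function of the paths of height at most `k` that
start at height `2 J`, with `z` marking the number of peaks. -/
noncomputable def pathSeries (k J : ℕ) : ℤ⟦X⟧⟦X⟧ :=
  series k (k + 1 - 2 * J)

/-- The generating function of the paths that start at height `2 J` and are continuations of an `NE`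
step, so that an initial `SE` step creates a peak at the starting point. -/
noncomputable def upSeries (k J : ℕ) : ℤ⟦X⟧⟦X⟧ :=
  pathSeries k J - (1 - X) * shift (pathSeries k (J - 1))

theorem pathSeries_eq_of_lt {k J : ℕ} (h : 2 * J + 2 ≤ k) :
    pathSeries k J = shift (upSeries k (J + 1)) + C (X : ℤ⟦X⟧) * X * shift (pathSeries k J)
      + shift (pathSeries k (if J = 0 then 1 else J - 1)) := by
  obtain ⟨t, rfl⟩ : ∃ t, k = t + 2 := ⟨k - 2, by omega⟩
  obtain ⟨h1, h2, -⟩ := series_relations t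
  have key : ThreeTerm (pathSeries (t + 2) J)
      (pathSeries (t + 2) (J + 1) + pathSeries (t + 2) (if J = 0 then 1 else J - 1)) := by
    by_cases hJ : J = 0
    · subst hJ
      exact h1
    · rw [if_neg hJ]
      have := h2 (t + 1 - 2 * J) (by omega) (by omega) (by omega)
      unfold pathSeries
      convert this using 3 <;> omega
  unfold ThreeTerm at key
  rw [map_add] at key
  rw [upSeries, map_sub, map_mul, map_sub, map_one, shift_X, Nat.add_sub_cancel]
  linear_combination -key

theorem pathSeries_eq_of_odd {k J : ℕ} (h : 2 * J + 1 = k) (hJ : J ≠ 0) :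
    pathSeries k J = C (X : ℤ⟦X⟧) * X * shift (pathSeries k J) + shift (pathSeries k (J - 1)) := by
  obtain ⟨t, rfl⟩ : ∃ t, k = t + 2 := ⟨k - 2, by omega⟩
  have := (series_relations t).2.2 (by omega)
  unfold pathSeries
  rwa [show t + 2 + 1 - 2 * J = 2 by omega, show t + 2 + 1 - 2 * (J - 1) = 4 by omega]

theorem pathSeries_eq_of_even {k J : ℕ} (h : 2 * J = k) (hJ : J ≠ 0) :
    pathSeries k J = shift (pathSeries k (J - 1)) := by
  obtain ⟨t, rfl⟩ : ∃ t, k = t + 2 := ⟨k - 2, by omega⟩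
  have := series_one t (Nat.even_iff.2 (by omega))
  unfold pathSeries
  convert this using 3 <;> omega

theorem coeff_zero_pathSeries {k J : ℕ} (hk : 2 ≤ k) : coeff 0 (pathSeries k J) = 1 := by
  obtain ⟨t, rfl⟩ : ∃ t, k = t + 2 := ⟨k - 2, by omega⟩
  rw [pathSeries, coeff_series, Finset.Nat.antidiagonalTuple_zero_right, sum_singleton]
  have hp : ∀ j, part (t + 2) (0 : Fin (t + 1) → ℕ) j = 0 := fun j => by
    unfold part
    split_ifs <;> rfl
  have hi : invOfUnit (1 : ℤ⟦X⟧) 1 = 1 := (eq_invOfUnit_of_mul_eq_one (by simp) (by simp)).symm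
  simp [summand, expo, denominator, partialSum, hp, qPoch, hi]

end Multisum

/-! ### Relative heights and valleys -/

namespace LatticePath

open PathStep

theorem height_zero (s : ℕ) (L : List PathStep) : height s L 0 = s := by simp [height]

theorem height_succ {s : ℕ} {L : List PathStep} {i : ℕ} {c : PathStep} (h : L[i]? = some c) :
    height s L (i + 1) = height s L i + c.rise := by
  rw [height, height, List.take_add_one, h]
  simp [add_assoc]

theorem height_succ_NE {s : ℕ} {L : List PathStep} {i : ℕ} (h : L[i]? = some NE) :
    height s L (i + 1) = height s L i + 1 := height_succ h

theorem height_succ_SE {s : ℕ} {L : List PathStep} {i : ℕ} (h : L[i]? = some SE) :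
    height s L (i + 1) = height s L i - 1 := height_succ h

theorem height_succ_E {s : ℕ} {L : List PathStep} {i : ℕ} (h : L[i]? = some E) :
    height s L (i + 1) = height s L i := by
  rw [height_succ h, rise, add_zero]

theorem step_cases {L : List PathStep} {i : ℕ} (h : i < L.length) :
    L[i]? = some NE ∨ L[i]? = some SE ∨ L[i]? = some E := by
  rw [List.getElem?_eq_getElem h]
  cases L[i] <;> simp

theorem lt_length_of_getElem? {L : List PathStep} {i : ℕ} {c : PathStep} (h : L[i]? = some c) :
    i < L.length :=
  (List.getElem?_eq_some_iff.1 h).1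

theorem eastStepsBefore_succ {L : List PathStep} {i : ℕ} {c : PathStep} (h : L[i]? = some c) :
    eastStepsBefore L (i + 1) = eastStepsBefore L i + if c = E then 1 else 0 := by
  rw [eastStepsBefore, eastStepsBefore, List.take_add_one, h]
  cases c <;> simp

theorem height_add_eastStepsBefore_modEq (s : ℕ) {L : List PathStep} {i : ℕ} (hi : i ≤ L.length) :
    (height s L i + eastStepsBefore L i + i) % 2 = (s : ℤ) % 2 := by
  induction i with
  | zero => simp [height_zero, eastStepsBefore]
  | succ i ih =>
    have ih := ih (by omega)
    rcases step_cases (L := L) (i := i) (by omega) with h | h | h <;>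
      rw [eastStepsBefore_succ h, height_succ h] <;> simp only [rise] <;> push_cast <;>
      simp <;> omega

theorem exists_leftmost_highest_peak (s : ℕ) (L : List PathStep) {i j x : ℕ} (hx : IsPeak L x)
    (hix : i < x) (hxj : x < j) :
    ∃ z, i < z ∧ z < j ∧ IsPeak L z ∧ height s L x ≤ height s L z ∧
      ∀ w, i < w → w < j → IsPeak L w →
        height s L w ≤ height s L z ∧ (height s L w = height s L z → z ≤ w) := by
  let P := (Finset.Ioo i j).filter (IsPeak L)
  have hP : ∀ w, w ∈ P ↔ (i < w ∧ w < j) ∧ IsPeak L w := fun w => by simp [P]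
  obtain ⟨m, hm, hmax⟩ := P.exists_max_image (height s L) ⟨x, (hP x).2 ⟨⟨hix, hxj⟩, hx⟩⟩
  obtain ⟨z, hz, hmin⟩ := (P.filter fun w => height s L w = height s L m).exists_min_image id
    ⟨m, by simp [hm]⟩
  rw [Finset.mem_filter, hP] at hz
  refine ⟨z, hz.1.1.1, hz.1.1.2, hz.1.2, ?_, fun w hw1 hw2 hw => ?_⟩
  · rw [hz.2]
    exact hmax x ((hP x).2 ⟨⟨hix, hxj⟩, hx⟩)
  · have hwP := (hP w).2 ⟨⟨hw1, hw2⟩, hw⟩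
    rw [hz.2]
    exact ⟨hmax w hwP, fun h => hmin w (Finset.mem_filter.2 ⟨hwP, h⟩)⟩

theorem IsPeak.lt_length {L : List PathStep} {x : ℕ} (hx : IsPeak L x) : x < L.length :=
  lt_length_of_getElem? hx.2.2

theorem IsLatticePath.one_le_height_of_isPeak {s : ℕ} {L : List PathStep} (hL : IsLatticePath s L)
    {x : ℕ} (hx : IsPeak L x) : 1 ≤ height s L x := by
  have := hL.nonneg (x + 1) hx.lt_length
  rw [height_succ_SE hx.2.2] at this
  omega

theorem IsLatticePath.exists_isPeak {s : ℕ} {L : List PathStep} (hL : IsLatticePath s L) {i j : ℕ}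
    (hij : i < j) (hj : j ≤ L.length) (hi : L[i]? = some NE)
    (hle : height s L j ≤ height s L i) : ∃ z, i < z ∧ z < j ∧ IsPeak L z := by
  have hup : ∀ d, (∀ t < d, L[i + t]? = some NE) → height s L (i + d) = height s L i + d := by
    intro d
    induction d with
    | zero => simp
    | succ d ih =>
      intro h
      rw [← add_assoc, height_succ_NE (h d (by omega)), ih fun t ht => h t (by omega)]
      push_cast
      ring
  have hex : ∃ d, L[i + d]? ≠ some NE := by
    by_contra! hcon
    have := hup (j - i) fun t _ => hcon t
    rw [Nat.add_sub_cancel' hij.le] at this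
    omega
  obtain ⟨d, hd, hmin⟩ : ∃ d, L[i + d]? ≠ some NE ∧ ∀ t < d, L[i + t]? = some NE :=
    ⟨Nat.find hex, Nat.find_spec hex, fun t ht => not_not.1 (Nat.find_min hex ht)⟩
  have hd0 : 0 < d := by
    rcases Nat.eq_zero_or_pos d with rfl | h
    · exact absurd hi hd
    · exact h
  have hdj : i + d < j := by
    by_contra! hcon
    have := hup (j - i) fun t ht => hmin t (by omega)
    rw [Nat.add_sub_cancel' hij.le] at this
    omega
  have hhd := hup d hmin
  have h0 := hL.nonneg i (by omega)
  refine ⟨i + d, by omega, hdj, by omega, ?_, ?_⟩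
  · have := hmin (d - 1) (by omega)
    rwa [show i + (d - 1) = i + d - 1 by omega] at this
  · rcases step_cases (L := L) (i := i + d) (by omega) with h | h | h
    · exact absurd h hd
    · exact h
    · have := hL.east_on_axis _ h
      omega

/-- The conditions on relative heights in the definition of `admissiblePaths`, reformulated without
relative heights: every peak is preceded by an even number of `E` steps, peaks preceded by `2 mod 4`
of them have height at most `k - 2`, and all valleys have even height. -/
def HasEvenValleys (k s : ℕ) (L : List PathStep) : Prop :=
  (∀ x, IsPeak L x → Even (eastStepsBefore L x) ∧
    (eastStepsBefore L x % 4 = 2 → height s L x ≤ (k : ℤ) - 2)) ∧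
  ∀ x, L[x]? = some SE → L[x + 1]? = some NE → Even (height s L (x + 1))

/-- The leftmost highest peak of an excursion from the `x`-axis has its full height as relative
height. -/
theorem IsLatticePath.exists_isRelativeHeight_eq_height {s : ℕ} {L : List PathStep}
    (hL : IsLatticePath s L) {x : ℕ} (hx : IsPeak L x) (he : 0 < eastStepsBefore L x) :
    ∃ z, IsPeak L z ∧ eastStepsBefore L z = eastStepsBefore L x ∧
      height s L x ≤ height s L z ∧ IsRelativeHeight s L z (height s L z) := by
  have hx1 := hL.one_le_height_of_isPeak hx
  have hxlen := hx.lt_length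
  obtain ⟨i0, hi0x, hi0⟩ : ∃ i < x, L[i]? = some E := by
    rw [eastStepsBefore, List.count_pos_iff, List.mem_take_iff_getElem] at he
    obtain ⟨i, hi, hEq⟩ := he
    exact ⟨i, by omega, by rw [← hEq]; exact List.getElem?_eq_getElem _⟩
  obtain ⟨i, hix, hi, himax⟩ : ∃ i < x, height s L i = 0 ∧
      ∀ p, i < p → p ≤ x → height s L p ≠ 0 := by
    have h1 := Nat.findGreatest_spec (P := fun p => height s L p = 0) hi0x.le
      (hL.east_on_axis i0 hi0)
    refine ⟨Nat.findGreatest (fun p => height s L p = 0) x, ?_, h1, fun p hp hpx =>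
      Nat.findGreatest_is_greatest hp hpx⟩
    refine lt_of_le_of_ne (Nat.findGreatest_le x) fun h => ?_
    rw [h] at h1
    omega
  have hex : ∃ j, x < j ∧ height s L j = 0 := ⟨L.length, hxlen, hL.ends_on_axis⟩
  obtain ⟨j, hxj, hj, hjmin⟩ : ∃ j, x < j ∧ height s L j = 0 ∧
      ∀ p, x < p → p < j → height s L p ≠ 0 :=
    ⟨Nat.find hex, (Nat.find_spec hex).1, (Nat.find_spec hex).2, fun p hp hpj h =>
      Nat.find_min hex hpj ⟨hp, h⟩⟩
  have hjlen : j ≤ L.length := by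
    by_contra! hcon
    exact hjmin _ hxlen hcon hL.ends_on_axis
  have hpos : ∀ p, i < p → p < j → height s L p ≠ 0 := fun p hp hpj => by
    rcases le_or_gt p x with h | h
    · exact himax p hp h
    · exact hjmin p h hpj
  have heast : ∀ d, i + d < j → eastStepsBefore L (i + d) = eastStepsBefore L i := by
    intro d
    induction d with
    | zero => simp
    | succ d ih =>
      intro hd
      have hne : L[i + d]? ≠ some E := fun h => by
        have h1 := hL.east_on_axis _ h
        have h2 := height_succ_E (s := s) h
        exact hpos (i + d + 1) (by omega) hd (h2.trans h1)
      rw [← ih (by omega), ← add_assoc]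
      rcases step_cases (L := L) (i := i + d) (by omega) with h | h | h
      · simp [eastStepsBefore_succ h]
      · simp [eastStepsBefore_succ h]
      · exact absurd h hne
  obtain ⟨z, hiz, hzj, hz, hxz, hmax⟩ := exists_leftmost_highest_peak s L hx hix hxj
  refine ⟨z, hz, ?_, hxz, ⟨i, j, hiz, hzj, hjlen, by omega, by omega, hmax⟩, ?_⟩
  · have h1 := heast (z - i) (by omega)
    have h2 := heast (x - i) (by omega)
    rw [Nat.add_sub_cancel' hiz.le] at h1
    rw [Nat.add_sub_cancel' hix.le] at h2
    rw [h1, h2]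
  · rintro h ⟨a, b, hza, hzb, hblen, hya, -, -⟩
    have := hL.nonneg a (by omega)
    omega

/-- Every valley strictly above the axis is the base of a peak: the leftmost highest peak on one of
its two sides, before the path drops below the valley, has relative height measured from it. -/
theorem IsLatticePath.exists_isRelativeHeight_of_valley {s : ℕ} {L : List PathStep}
    (hL : IsLatticePath s L) {w : ℕ} (hSE : L[w]? = some SE) (hNE : L[w + 1]? = some NE)
    (hv : 0 < height s L (w + 1)) :
    ∃ z, IsPeak L z ∧ IsRelativeHeight s L z (height s L z - height s L (w + 1)) := by
  set v := height s L (w + 1) with hvdef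
  have hwlen := lt_length_of_getElem? hNE
  have hw0 : height s L w = v + 1 := by
    have := height_succ_SE (s := s) hSE
    omega
  have hw2 : height s L (w + 2) = v + 1 := height_succ_NE hNE
  -- `R + 1` is the first vertex on the right below height `v`
  obtain ⟨R, hwR, hRlen, hR, hR1, hright⟩ : ∃ R, w + 1 < R ∧ R < L.length ∧ height s L R = v ∧
      height s L (R + 1) < v ∧ ∀ p, w + 1 ≤ p → p ≤ R → v ≤ height s L p := by
    have hex : ∃ j, w + 1 < j ∧ height s L j < v := ⟨L.length, hwlen, by
      rw [hL.ends_on_axis]; exact hv⟩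
    have h1 := Nat.find_spec hex
    have h2 : ∀ p, w + 1 < p → p < Nat.find hex → v ≤ height s L p := fun p hp hpj => by
      have := Nat.find_min hex hpj
      push Not at this
      exact this hp
    have h3 : Nat.find hex ≤ L.length := Nat.find_min' hex ⟨hwlen, by
      rw [hL.ends_on_axis]; exact hv⟩
    generalize Nat.find hex = j at h1 h2 h3
    obtain ⟨R, rfl⟩ : ∃ R, j = R + 1 := ⟨j - 1, by omega⟩
    have hne : w + 1 ≠ R := fun h => by
      subst h
      have : height s L (w + 1 + 1) = v + 1 := hw2
      omega
    have h4 := h2 R (by omega) (by omega)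
    refine ⟨R, by omega, by omega, ?_, h1.2, fun p hp hpR => ?_⟩
    · rcases step_cases (L := L) (i := R) (by omega) with h | h | h <;>
        have := height_succ (s := s) h <;> simp only [rise] at this <;> omega
    · rcases Nat.eq_or_lt_of_le hp with rfl | hp
      · exact le_rfl
      · exact h2 p hp (by omega)
  obtain ⟨z0, hz01, hz02, hz0⟩ := hL.exists_isPeak hwR hRlen.le hNE (by omega)
  obtain ⟨z, hwz, hzR, hz, -, hzmax⟩ := exists_leftmost_highest_peak s L hz0 hz01 hz02
  by_cases hcase : ∀ u < z, height s L u < v →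
      ∃ p, u < p ∧ p < z ∧ IsPeak L p ∧ height s L z ≤ height s L p
  · refine ⟨z, hz, ⟨w + 1, R, hwz, hzR, hRlen.le, by omega, by omega, hzmax⟩, ?_⟩
    rintro h ⟨a, b, haz, hzb, hblen, hya, hyb, hab⟩
    by_contra! hcon
    obtain ⟨p, hap, hpz, hp, hzp⟩ := hcase a haz (by omega)
    have := hab p hap (by omega) hp
    have := this.2 (by omega)
    omega
  · push Not at hcase
    obtain ⟨u, huz, huv, hu⟩ := hcase
    have huw : u < w := by
      by_contra! hcon
      rcases Nat.eq_or_lt_of_le hcon with rfl | h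
      · omega
      · have := hright u (by omega) (by omega)
        omega
    -- `l` is the last vertex on the left below height `v`
    obtain ⟨l, hlw, hul, hl, hleft⟩ : ∃ l < w, u ≤ l ∧ height s L l < v ∧
        ∀ p, l < p → p ≤ w → v ≤ height s L p := by
      have h1 := Nat.findGreatest_spec (P := fun p => height s L p < v) huw.le huv
      refine ⟨Nat.findGreatest (fun p => height s L p < v) w, ?_,
        Nat.le_findGreatest huw.le huv, h1, fun p hp hpx =>
        not_lt.1 (Nat.findGreatest_is_greatest hp hpx)⟩
      refine lt_of_le_of_ne (Nat.findGreatest_le w) fun h => ?_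
      rw [h] at h1
      omega
    have hl0 := hleft (l + 1) (by omega) (by omega)
    have hl1 : height s L (l + 1) = v := by
      rcases step_cases (L := L) (i := l) (by omega) with h | h | h <;>
        have := height_succ (s := s) h <;> simp only [rise] at this <;> omega
    have hlw1 : l + 1 ≠ w := fun h => by
      rw [h] at hl1
      omega
    have hl2 := hleft (l + 2) (by omega) (by omega)
    have hlNE : L[l + 1]? = some NE := by
      rcases step_cases (L := L) (i := l + 1) (by omega) with h | h | h
      · exact h
      · have := height_succ_SE (s := s) h
        rw [show l + 1 + 1 = l + 2 from rfl] at this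
        omega
      · have := hL.east_on_axis _ h
        omega
    obtain ⟨y0, hy01, hy02, hy0⟩ := hL.exists_isPeak (i := l + 1) (j := w + 1) (by omega) hwlen.le
      hlNE (by omega)
    obtain ⟨y, hly, hyw, hy, -, hymax⟩ := exists_leftmost_highest_peak s L hy0 hy01 hy02
    refine ⟨y, hy, ⟨l + 1, w + 1, hly, hyw, hwlen.le, by omega, by omega, hymax⟩, ?_⟩
    rintro h ⟨a, b, hay, hyb, hblen, hya, hyb', hab⟩
    by_contra! hcon
    have hbR : R < b := by
      by_contra! hbR
      rcases le_or_gt (w + 1) b with hb | hb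
      · have := hright b hb hbR
        omega
      · have := hleft b (by omega) (by omega)
        omega
    have h1 := (hab z (by omega) (by omega) hz).1
    have h2 := hu y (by omega) (by omega) hy
    omega

/-- If all valleys have even height and the path starts at even height, the base of every peak, from
which its relative height is measured, has even height: an odd base could be lowered by one. -/
theorem IsLatticePath.even_height_sub_of_isRelativeHeight {s : ℕ} {L : List PathStep}
    (hL : IsLatticePath s L) (hs : Even s)
    (hval : ∀ x, L[x]? = some SE → L[x + 1]? = some NE → Even (height s L (x + 1)))
    {x : ℕ} {r : ℤ} (hx : IsPeak L x) (hr : IsRelativeHeight s L x r) :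
    Even (height s L x - r) := by
  obtain ⟨⟨a, b, hax, hxb, hblen, hya, hyb, hab⟩, hmax⟩ := hr
  have hxlen := hx.lt_length
  by_contra hodd
  have hv0 : 0 ≤ height s L x - r := hya ▸ hL.nonneg a (by omega)
  have hv : height s L x - r ≠ 0 := fun h => hodd (by rw [h]; exact Even.zero)
  obtain ⟨a', ha'x, ha', haa'⟩ : ∃ a' < x, height s L a' = height s L x - (r + 1) ∧
      ∀ z, a' < z → IsPeak L z → a < z := by
    rcases step_cases (L := L) (i := a) (by omega) with h | h | h
    · have hnp : ¬ IsPeak L a := fun hp => by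
        have := hp.2.2
        rw [h] at this
        simp at this
      have ha0 : a ≠ 0 := by
        rintro rfl
        rw [← hya, height_zero] at hodd
        exact hodd (by exact_mod_cast hs)
      obtain ⟨c, rfl⟩ : ∃ c, a = c + 1 := ⟨a - 1, by omega⟩
      rcases step_cases (L := L) (i := c) (by omega) with h' | h' | h'
      · have := height_succ_NE (s := s) h'
        refine ⟨c, by omega, by omega, fun z hz hp => ?_⟩
        rcases Nat.eq_or_lt_of_le hz with rfl | hz
        · exact absurd hp hnp
        · exact hz
      · exact absurd (hya ▸ hval c h' h) hodd
      · have h1 := height_succ_E (s := s) h'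
        have h2 := hL.east_on_axis _ h'
        omega
    · have h1 := height_succ_SE (s := s) h
      have h2 : a + 1 ≠ x := by
        rintro rfl
        have := hx.2.1
        rw [Nat.add_sub_cancel, h] at this
        simp at this
      exact ⟨a + 1, by omega, by omega, fun z hz _ => by omega⟩
    · have h2 := hL.east_on_axis _ h
      omega
  obtain ⟨b', hxb', hb'len, hb', hbb'⟩ : ∃ b', x < b' ∧ b' ≤ L.length ∧
      height s L b' = height s L x - (r + 1) ∧ ∀ z, z < b' → IsPeak L z → z < b := by
    obtain ⟨c, rfl⟩ : ∃ c, b = c + 1 := ⟨b - 1, by omega⟩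
    rcases step_cases (L := L) (i := c) (by omega) with h | h | h
    · have h1 := height_succ_NE (s := s) h
      have h2 : c ≠ x := by
        rintro rfl
        have := hx.2.2
        rw [h] at this
        simp at this
      exact ⟨c, by omega, by omega, by omega, fun z hz _ => by omega⟩
    · have hnp : ¬ IsPeak L (c + 1) := fun hp => by
        have := hp.2.1
        rw [Nat.add_sub_cancel, h] at this
        simp at this
      have hlen : c + 1 ≠ L.length := fun hc => by
        have := hL.ends_on_axis
        rw [← hc] at this
        omega
      rcases step_cases (L := L) (i := c + 1) (by omega) with h' | h' | h'
      · exact absurd (hyb ▸ hval c h h') hodd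
      · have := height_succ_SE (s := s) h'
        refine ⟨c + 1 + 1, by omega, by omega, by omega, fun z hz hp => ?_⟩
        rcases Nat.eq_or_lt_of_le (Nat.le_of_lt_succ hz) with rfl | hz
        · exact absurd hp hnp
        · exact hz
      · have h2 := hL.east_on_axis _ h'
        omega
    · have h1 := height_succ_E (s := s) h
      have h2 := hL.east_on_axis _ h
      omega
  have := hmax ⟨a', b', ha'x, hxb', hb'len, ha', hb', fun z h1 h2 hp =>
    hab z (haa' z h1 hp) (hbb' z h2 hp) hp⟩
  omega

theorem IsLatticePath.hasEvenValleys_iff {k s : ℕ} {L : List PathStep} (hL : IsLatticePath s L)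
    (hs : Even s) (hk : ∀ i ≤ L.length, height s L i ≤ k) :
    HasEvenValleys k s L ↔
      (∀ (x : ℕ) (r : ℤ), IsPeak L x → IsRelativeHeight s L x r →
        (r = k ∨ r = (k : ℤ) - 1) → 4 ∣ eastStepsBefore L x) ∧
      (∀ (x : ℕ) (r : ℤ), IsPeak L x → IsRelativeHeight s L x r → (x : ℤ) ≡ r [ZMOD 2]) := by
  have hs2 : (s : ℤ) % 2 = 0 := by
    have := Nat.even_iff.1 hs
    omega
  constructor
  · rintro ⟨hpeak, hval⟩
    refine ⟨fun x r hx hr hrk => ?_, fun x r hx hr => ?_⟩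
    · have h1 := Int.even_iff.1 (hL.even_height_sub_of_isRelativeHeight hs hval hx hr)
      obtain ⟨h2, h3⟩ := hpeak x hx
      rw [Nat.even_iff] at h2
      have h4 := hk x hx.lt_length.le
      obtain ⟨⟨a, b, hax, -, -, hya, -, -⟩, -⟩ := hr
      have h5 := hL.nonneg a (hax.le.trans hx.lt_length.le)
      omega
    · have h1 := Int.even_iff.1 (hL.even_height_sub_of_isRelativeHeight hs hval hx hr)
      have h2 := Nat.even_iff.1 (hpeak x hx).1
      have h3 := height_add_eastStepsBefore_modEq s hx.lt_length.le
      rw [Int.ModEq]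
      omega
  · rintro ⟨h4, h2⟩
    have hpeak : ∀ x, IsPeak L x → Even (eastStepsBefore L x) ∧
        (eastStepsBefore L x % 4 = 2 → height s L x ≤ (k : ℤ) - 2) := by
      intro x hx
      rcases Nat.eq_zero_or_pos (eastStepsBefore L x) with he | he
      · rw [he]
        exact ⟨Even.zero, fun h => by omega⟩
      · obtain ⟨z, hz, hze, hxz, hr⟩ := hL.exists_isRelativeHeight_eq_height hx he
        have h5 := h2 z _ hz hr
        rw [Int.ModEq] at h5
        have h6 := height_add_eastStepsBefore_modEq s hz.lt_length.le
        have h7 := hk z hz.lt_length.le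
        have h8 := h4 z _ hz hr
        rw [← hze, Nat.even_iff]
        refine ⟨by omega, fun h => ?_⟩
        by_contra! hcon
        have := h8 (by omega)
        omega
    refine ⟨hpeak, fun w hSE hNE => ?_⟩
    by_contra hodd
    rw [Int.even_iff] at hodd
    have h0 := hL.nonneg (w + 1) (lt_length_of_getElem? hNE).le
    obtain ⟨z, hz, hr⟩ := hL.exists_isRelativeHeight_of_valley hSE hNE (by omega)
    have h5 := h2 z _ hz hr
    rw [Int.ModEq] at h5
    have h6 := height_add_eastStepsBefore_modEq s hz.lt_length.le
    have h7 := Nat.even_iff.1 (hpeak z hz).1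
    omega

end LatticePath

namespace LatticePath

open PathStep

/-! ### Admissibility as a step-by-step condition -/

/-- The local condition at a vertex of height `h`, preceded by `e` east steps: `p` and `c` are the
steps before and after the vertex, `none` at the beginning and at the end of the path. -/
structure LocalRule (k : ℕ) (p c : Option PathStep) (h : ℤ) (e : ℕ) : Prop where
  nonneg : 0 ≤ h
  le : h ≤ k
  terminal : c = none → h = 0 ∧ (p = none ∨ p = some SE)
  east : c = some E → h = 0
  valley : p = some SE → c = some NE → Even h
  peak : p = some NE → c = some SE → Even e ∧ (e % 4 = 2 → h ≤ (k : ℤ) - 2)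

/-- `Valid k p h e L`: the steps `L` can follow the step `p` at a vertex of height `h` preceded by `e`
east steps. -/
def Valid (k : ℕ) : Option PathStep → ℤ → ℕ → List PathStep → Prop
  | p, h, e, [] => LocalRule k p none h e
  | p, h, e, c :: L => LocalRule k p (some c) h e ∧
      Valid k (some c) (h + c.rise) (e + if c = E then 1 else 0) L

/-- The number of peaks of the path `L` that continues the step `p`. -/
def numPeaks : Option PathStep → List PathStep → ℕ
  | _, [] => 0
  | p, c :: L => (if p = some NE ∧ c = SE then 1 else 0) + numPeaks (some c) L

/-- The sum of the weights of the peaks of the path `L` that continues the step `p` at abscissa `x`. -/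
def peakWeight : ℕ → Option PathStep → List PathStep → ℕ
  | _, _, [] => 0
  | x, p, c :: L => (if p = some NE ∧ c = SE then x else 0) + peakWeight (x + 1) (some c) L

/-- The step of `L` before its `i`-th vertex, or `p` for the initial vertex. -/
def stepBefore (p : Option PathStep) (L : List PathStep) : ℕ → Option PathStep
  | 0 => p
  | i + 1 => L[i]?

theorem stepBefore_cons_succ (p : Option PathStep) (c : PathStep) (L : List PathStep) (i : ℕ) :
    stepBefore p (c :: L) (i + 1) = stepBefore (some c) L i := by
  cases i <;> simp [stepBefore]

theorem valid_iff_forall {k : ℕ} (p : Option PathStep) (h : ℤ) (e : ℕ) (L : List PathStep) :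
    Valid k p h e L ↔ ∀ i ≤ L.length, LocalRule k (stepBefore p L i) L[i]?
      (h + ((L.take i).map rise).sum) (e + (L.take i).count E) := by
  induction L generalizing p h e with
  | nil => simp [Valid, stepBefore]
  | cons c L ih =>
    rw [Valid, ih]
    constructor
    · rintro ⟨h1, h2⟩ i hi
      cases i with
      | zero => simpa [stepBefore] using h1
      | succ i =>
        have := h2 i (by simpa using hi)
        rw [stepBefore_cons_succ]
        simpa [List.count_cons, add_assoc, add_comm, add_left_comm] using this
    · intro H
      refine ⟨by simpa [stepBefore] using H 0 (by simp), fun i hi => ?_⟩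
      have := H (i + 1) (by simpa using hi)
      rw [stepBefore_cons_succ] at this
      simpa [List.count_cons, add_assoc, add_comm, add_left_comm] using this

theorem peakWeight_eq_sum (x : ℕ) (p : Option PathStep) (L : List PathStep) :
    peakWeight x p L = ∑ i ∈ Finset.range L.length,
      if stepBefore p L i = some NE ∧ L[i]? = some SE then x + i else 0 := by
  induction L generalizing p x with
  | nil => simp [peakWeight]
  | cons c L ih =>
    rw [peakWeight, ih, List.length_cons, Finset.sum_range_succ', add_comm]
    congr 1
    · refine Finset.sum_congr rfl fun i _ => ?_
      rw [stepBefore_cons_succ, List.getElem?_cons_succ, add_assoc, add_comm 1 i]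
    · simp [stepBefore]

theorem majorIndex_eq_peakWeight (L : List PathStep) : majorIndex L = peakWeight 0 none L := by
  rw [majorIndex, Finset.sum_filter, peakWeight_eq_sum]
  refine Finset.sum_congr rfl fun i _ => ?_
  cases i with
  | zero => simp
  | succ i => simp [IsPeak, stepBefore]

/-- Along a whole path, the local conditions amount to those defining an admissible path. -/
theorem valid_iff {k s : ℕ} (L : List PathStep) :
    Valid k none s 0 L ↔
      IsLatticePath s L ∧ (∀ i ≤ L.length, height s L i ≤ k) ∧ HasEvenValleys k s L := by
  rw [valid_iff_forall]
  have hh : ∀ i, (s : ℤ) + ((L.take i).map rise).sum = height s L i := fun i => rfl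
  have he : ∀ i, 0 + (L.take i).count E = eastStepsBefore L i := fun i => by
    rw [zero_add, eastStepsBefore]
  simp_rw [hh, he]
  constructor
  · intro H
    refine ⟨⟨fun i hi => (H i hi).nonneg, ?_, fun i hi => ?_, ?_⟩, fun i hi => (H i hi).le,
      fun x hx => ?_, fun x h1 h2 => ?_⟩
    · exact ((H _ le_rfl).terminal (by simp)).1
    · exact (H i (lt_length_of_getElem? hi).le).east hi
    · have := ((H _ le_rfl).terminal (by simp)).2
      rw [List.getLast?_eq_getElem?]
      cases L with
      | nil => simp
      | cons c L => simpa [stepBefore] using this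
    · obtain ⟨y, rfl⟩ : ∃ y, x = y + 1 := ⟨x - 1, by have := hx.1; omega⟩
      exact (H _ hx.lt_length.le).peak hx.2.1 hx.2.2
    · exact (H _ (lt_length_of_getElem? h2).le).valley h1 h2
  · rintro ⟨hL, hk, hpeak, hval⟩ i hi
    refine ⟨hL.nonneg i hi, hk i hi, fun h => ?_, hL.east_on_axis i, fun h1 h2 => ?_,
      fun h1 h2 => ?_⟩
    · obtain rfl : i = L.length := le_antisymm hi (by simpa using h)
      refine ⟨hL.ends_on_axis, ?_⟩
      have := hL.last_step
      rw [List.getLast?_eq_getElem?] at this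
      cases L with
      | nil => simp [stepBefore]
      | cons c L => simpa [stepBefore] using this
    · cases i with
      | zero => simp [stepBefore] at h1
      | succ i => exact hval i h1 h2
    · cases i with
      | zero => simp [stepBefore] at h1
      | succ i => exact hpeak (i + 1) ⟨by omega, h1, h2⟩

theorem Valid.nonneg {k : ℕ} {p : Option PathStep} {h : ℤ} {e : ℕ} {L : List PathStep}
    (H : Valid k p h e L) : 0 ≤ h := by
  cases L with
  | nil => exact LocalRule.nonneg H
  | cons c L => exact H.1.nonneg

theorem Valid.le {k : ℕ} {p : Option PathStep} {h : ℤ} {e : ℕ} {L : List PathStep}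
    (H : Valid k p h e L) : h ≤ k := by
  cases L with
  | nil => exact LocalRule.le H
  | cons c L => exact H.1.le

/-- An ascending path must reach a peak, so the restrictions on peaks apply to it at once. -/
theorem Valid.of_NE {k : ℕ} {h : ℤ} {e : ℕ} {L : List PathStep}
    (H : Valid k (some NE) h e L) (hh : 1 ≤ h) :
    Even e ∧ (e % 4 = 2 → h ≤ (k : ℤ) - 2) ∧ 1 ≤ numPeaks (some NE) L := by
  induction L generalizing h with
  | nil =>
    have := LocalRule.terminal H rfl
    omega
  | cons c L ih =>
    cases c with
    | NE =>
      have h1 := H.2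
      simp only [rise, reduceCtorEq, if_false, add_zero] at h1
      obtain ⟨h2, h3, h4⟩ := ih h1 (by omega)
      refine ⟨h2, fun h => ?_, by simpa [numPeaks] using h4⟩
      have := h3 h
      omega
    | SE =>
      have := H.1.peak rfl rfl
      exact ⟨this.1, this.2, by simp [numPeaks]⟩
    | E =>
      have := H.1.east rfl
      omega

theorem Valid.of_E {k : ℕ} {e : ℕ} {L : List PathStep} (H : Valid k (some E) 0 e L) :
    1 ≤ numPeaks (some E) L := by
  induction L generalizing e with
  | nil =>
    have := LocalRule.terminal H rfl
    simp at this
  | cons c L ih =>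
    cases c with
    | NE => simpa [numPeaks] using (H.2.of_NE (by simp [rise])).2.2
    | SE =>
      have := H.2.nonneg
      simp [rise] at this
    | E => simpa [numPeaks] using ih H.2

theorem Valid.eq_replicate {k : ℕ} {p : Option PathStep} {h : ℤ} {e : ℕ} {L : List PathStep}
    (H : Valid k p h e L) (hp : p ≠ some NE) (hN : numPeaks p L = 0) :
    L = List.replicate h.toNat SE := by
  induction L generalizing h p with
  | nil =>
    rw [(LocalRule.terminal H rfl).1]
    rfl
  | cons c L ih =>
    have h0 := H.nonneg
    cases c with
    | NE =>
      have := (H.2.of_NE (by simp only [rise]; omega)).2.2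
      simp [numPeaks] at hN
      omega
    | SE =>
      have h1 := H.2.nonneg
      have h2 : numPeaks (some SE) L = 0 := by
        simp [numPeaks] at hN
        exact hN.2
      have := ih H.2 (by simp) h2
      simp only [rise] at this h1
      rw [this, show h.toNat = (h + -1).toNat + 1 by omega, List.replicate_succ]
    | E =>
      have h1 := H.2
      rw [H.1.east rfl] at h1
      have := h1.of_E
      simp [numPeaks] at hN
      omega

theorem valid_replicate {k : ℕ} {p : Option PathStep} {n e : ℕ} (hn : n ≤ k)
    (hp : p = none ∨ p = some SE) : Valid k p n e (List.replicate n SE) := by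
  induction n generalizing p with
  | zero => constructor <;> simp [hp]
  | succ n ih =>
    rw [List.replicate_succ]
    refine ⟨⟨by omega, by omega, by simp, by simp, by simp, ?_⟩, ?_⟩
    · rintro rfl
      simp at hp
    · have := ih (by omega) (Or.inr rfl)
      simpa [rise] using this

theorem numPeaks_replicate {p : Option PathStep} (n : ℕ) (hp : p ≠ some NE) :
    numPeaks p (List.replicate n SE) = 0 := by
  induction n generalizing p with
  | zero => rfl
  | succ n ih => simp [List.replicate_succ, numPeaks, hp, ih]

theorem mul_numPeaks_le_peakWeight (x : ℕ) (p : Option PathStep) (L : List PathStep) :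
    x * numPeaks p L ≤ peakWeight x p L := by
  induction L generalizing x p with
  | nil => simp [numPeaks]
  | cons c L ih =>
    rw [numPeaks, peakWeight, mul_add]
    have := ih (x + 1) (some c)
    have h2 : x * numPeaks (some c) L ≤ (x + 1) * numPeaks (some c) L :=
      Nat.mul_le_mul_right _ (by omega)
    split_ifs <;> omega

theorem peakWeight_eq_zero (x : ℕ) {p : Option PathStep} {L : List PathStep}
    (h : numPeaks p L = 0) : peakWeight x p L = 0 := by
  induction L generalizing x p with
  | nil => rfl
  | cons c L ih =>
    rw [numPeaks] at h
    split_ifs at h with hc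
    · omega
    · rw [peakWeight, if_neg hc, ih (x + 1) (by omega)]

theorem numPeaks_congr {p p' : Option PathStep} (hp : p ≠ some NE) (hp' : p' ≠ some NE)
    (L : List PathStep) : numPeaks p L = numPeaks p' L := by
  cases L <;> simp [numPeaks, hp, hp']

theorem peakWeight_congr (x : ℕ) {p p' : Option PathStep} (hp : p ≠ some NE)
    (hp' : p' ≠ some NE) (L : List PathStep) : peakWeight x p L = peakWeight x p' L := by
  cases L <;> simp [peakWeight, hp, hp']

theorem valid_some_SE {k : ℕ} {h : ℤ} (hh : Even h) (e : ℕ) (L : List PathStep) :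
    Valid k (some SE) h e L ↔ Valid k none h e L := by
  have : ∀ c, LocalRule k (some SE) c h e ↔ LocalRule k none c h e := fun c =>
    ⟨fun H => ⟨H.nonneg, H.le, fun hc => ⟨(H.terminal hc).1, Or.inl rfl⟩, H.east, by simp, by simp⟩,
      fun H => ⟨H.nonneg, H.le, fun hc => ⟨(H.terminal hc).1, Or.inr rfl⟩, H.east, fun _ _ => hh,
        by simp⟩⟩
  cases L with
  | nil => exact this none
  | cons c L => exact and_congr (this _) Iff.rfl

theorem valid_some_E {k : ℕ} {h : ℤ} (e : ℕ) {L : List PathStep} (hL : L ≠ []) :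
    Valid k (some E) h e L ↔ Valid k none h e L := by
  cases L with
  | nil => exact absurd rfl hL
  | cons c L =>
    refine and_congr ⟨fun H => ⟨H.nonneg, H.le, by simp, H.east, by simp, by simp⟩,
      fun H => ⟨H.nonneg, H.le, by simp, H.east, by simp, by simp⟩⟩ Iff.rfl

/-! ### Counting by the first two steps -/

/-- `S` is a finite set with `c` elements; `c` is an integer so that it can be a coefficient of a
series. -/
def HasCard (S : Set (List PathStep)) (c : ℤ) : Prop :=
  S.Finite ∧ (S.ncard : ℤ) = c

theorem hasCard_of_isEmpty {S : Set (List PathStep)} (h : ∀ L, L ∉ S) : HasCard S 0 := by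
  rw [Set.eq_empty_of_forall_notMem h]
  exact ⟨Set.finite_empty, by simp⟩

theorem HasCard.union {S T : Set (List PathStep)} {a b : ℤ} (hS : HasCard S a) (hT : HasCard T b)
    (h : Disjoint S T) : HasCard (S ∪ T) (a + b) := by
  refine ⟨hS.1.union hT.1, ?_⟩
  rw [Set.ncard_union_eq h hS.1 hT.1, Nat.cast_add, hS.2, hT.2]

theorem HasCard.image {S : Set (List PathStep)} {a : ℤ} (hS : HasCard S a)
    {f : List PathStep → List PathStep} (hf : f.Injective) : HasCard (f '' S) a :=
  ⟨hS.1.image f, by rw [Set.ncard_image_of_injective S hf, hS.2]⟩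

/-- Splits a count of paths according to the first two steps: `NE NE`, `NE SE`, or a third kind of
beginning described by `g`, namely `SE SE`, or `E E` with the empty path as an exception. -/
theorem HasCard.of_two_steps {S : Set (List PathStep)} {g : List PathStep → List PathStep}
    (hg : g.Injective) (hgNE : ∀ L L', g L ≠ NE :: L')
    (hS : ∀ L ∈ S, (∃ L', L = NE :: NE :: L') ∨ (∃ L', L = NE :: SE :: L') ∨ ∃ L', L = g L')
    {a b c : ℤ} (ha : HasCard {L | NE :: NE :: L ∈ S} a) (hb : HasCard {L | NE :: SE :: L ∈ S} b)
    (hc : HasCard {L | g L ∈ S} c) : HasCard S (a + b + c) := by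
  have h1 : (fun L : List PathStep => NE :: NE :: L).Injective := fun L L' h => by simpa using h
  have h2 : (fun L : List PathStep => NE :: SE :: L).Injective := fun L L' h => by simpa using h
  have := ((ha.image h1).union (hb.image h2) ?_).union (hc.image hg) ?_
  · convert this using 1
    ext L
    constructor
    · intro hL
      rcases hS L hL with ⟨L', rfl⟩ | ⟨L', rfl⟩ | ⟨L', rfl⟩
      · exact Or.inl (Or.inl ⟨L', hL, rfl⟩)
      · exact Or.inl (Or.inr ⟨L', hL, rfl⟩)
      · exact Or.inr ⟨L', hL, rfl⟩
    · rintro ((⟨L', hL, rfl⟩ | ⟨L', hL, rfl⟩) | ⟨L', hL, rfl⟩) <;> exact hL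
  · rw [Set.disjoint_left]
    rintro _ ⟨L, -, rfl⟩ ⟨L', -, h⟩
    simp at h
  · rw [Set.disjoint_left]
    rintro _ (⟨L, -, rfl⟩ | ⟨L, -, rfl⟩) ⟨L', -, h⟩ <;> exact hgNE _ _ h

/-- The paths with `N` peaks of total weight `m` that can follow the step `p` at the vertex `(x, h)`
preceded by `e` east steps. -/
def runs (k : ℕ) (p : Option PathStep) (h : ℤ) (e x N m : ℕ) : Set (List PathStep) :=
  {L | Valid k p h e L ∧ numPeaks p L = N ∧ peakWeight x p L = m}

theorem runs_some_SE {k : ℕ} {h : ℤ} (hh : Even h) (e x N m : ℕ) :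
    runs k (some SE) h e x N m = runs k none h e x N m := by
  ext L
  simp only [runs, Set.mem_ofPred_eq, valid_some_SE hh,
    numPeaks_congr (p := some SE) (p' := none) (by simp) (by simp),
    peakWeight_congr x (p := some SE) (p' := none) (by simp) (by simp)]

theorem NE_NE_mem_runs {k : ℕ} {p : Option PathStep} (hp : p = none ∨ p = some NE) {h : ℤ}
    (h0 : 0 ≤ h) (e x N m : ℕ) (L : List PathStep) :
    NE :: NE :: L ∈ runs k p h e x N m ↔ L ∈ runs k (some NE) (h + 2) e (x + 2) N m := by
  have hr : h + rise NE + rise NE = h + 2 := by simp [rise]; ring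
  have hp' : p ≠ some SE := by rcases hp with rfl | rfl <;> simp
  simp only [runs, Set.mem_ofPred_eq, Valid, numPeaks, peakWeight, hr, reduceCtorEq, and_false,
    if_false, zero_add, add_zero, add_assoc, Nat.reduceAdd]
  constructor
  · rintro ⟨⟨-, -, H⟩, h2⟩
    exact ⟨H, h2⟩
  · rintro ⟨H, h2⟩
    have := H.le
    exact ⟨⟨⟨h0, by omega, by simp, by simp, fun h => absurd h hp', by simp⟩,
      ⟨by simp [rise]; omega, by simp [rise]; omega, by simp, by simp, by simp, by simp⟩, H⟩, h2⟩

theorem NE_SE_mem_runs {k : ℕ} {p : Option PathStep} (hp : p = none ∨ p = some NE) {h : ℤ}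
    (h0 : 0 ≤ h) (hh : Even h) {e : ℕ} (he : Even e) (x N m : ℕ) (L : List PathStep) :
    NE :: SE :: L ∈ runs k p h e x N m ↔ h + 1 + 2 * (e % 4 / 2 : ℕ) ≤ (k : ℤ) ∧
      Valid k none h e L ∧ 1 + numPeaks none L = N ∧ x + 1 + peakWeight (x + 2) none L = m := by
  have hr : h + (1 + rise SE) = h := by simp [rise]
  have hr1 : h + rise NE = h + 1 := by simp [rise]
  have hp' : p ≠ some SE := by rcases hp with rfl | rfl <;> simp
  have he2 := Nat.even_iff.1 he
  simp only [runs, Set.mem_ofPred_eq, Valid, numPeaks, peakWeight, hr, hr1, reduceCtorEq, and_false,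
    and_self, if_true, if_false, zero_add, add_zero, add_assoc, Nat.reduceAdd, valid_some_SE hh,
    numPeaks_congr (p := some SE) (p' := none) (by simp) (by simp),
    peakWeight_congr (x + 2) (p := some SE) (p' := none) (by simp) (by simp)]
  constructor
  · rintro ⟨⟨-, H1, H⟩, h2⟩
    have h3 := (H1.peak rfl rfl).2
    have h4 := H1.le
    exact ⟨by omega, H, h2⟩
  · rintro ⟨h3, H, h2⟩
    exact ⟨⟨⟨h0, by omega, by simp, by simp, fun h => absurd h hp', by simp⟩,
      ⟨by omega, by omega, by simp, by simp, by simp, fun _ _ => ⟨he, fun h => by omega⟩⟩, H⟩, h2⟩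

theorem SE_SE_mem_runs_none {k : ℕ} {h : ℤ} (h2 : 2 ≤ h) (hk : h ≤ k) (hh : Even h)
    (e x N m : ℕ) (L : List PathStep) :
    SE :: SE :: L ∈ runs k none h e x N m ↔ L ∈ runs k none (h - 2) e (x + 2) N m := by
  have hr : h - 1 + rise SE = h - 2 := by simp [rise]; ring
  have hr1 : h + rise SE = h - 1 := by simp [rise]; ring
  rw [← runs_some_SE (h := h - 2) (hh.sub even_two)]
  simp only [runs, Set.mem_ofPred_eq, Valid, numPeaks, peakWeight, hr, hr1, reduceCtorEq, false_and,
    Option.some.injEq, if_false, zero_add, add_zero, add_assoc, Nat.reduceAdd]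
  constructor
  · rintro ⟨⟨-, -, H⟩, h2⟩
    exact ⟨H, h2⟩
  · rintro ⟨H, h3⟩
    exact ⟨⟨⟨by omega, hk, by simp, by simp, by simp, by simp⟩,
      ⟨by omega, by omega, by simp, by simp, by simp, by simp⟩, H⟩, h3⟩

theorem SE_SE_mem_runs_NE {k : ℕ} {h : ℤ} (h2 : 2 ≤ h) (hh : Even h) {e : ℕ} (he : Even e)
    (hk : h + 2 * (e % 4 / 2 : ℕ) ≤ k) (x N m : ℕ) (L : List PathStep) :
    SE :: SE :: L ∈ runs k (some NE) h e x N m ↔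
      Valid k none (h - 2) e L ∧ 1 + numPeaks none L = N ∧
        x + peakWeight (x + 2) none L = m := by
  have hr : h - 1 + rise SE = h - 2 := by simp [rise]; ring
  have hr1 : h + rise SE = h - 1 := by simp [rise]; ring
  have he2 := Nat.even_iff.1 he
  simp only [runs, Set.mem_ofPred_eq, Valid, numPeaks, peakWeight, hr, hr1, reduceCtorEq, false_and,
    and_self, Option.some.injEq, if_true, if_false, zero_add, add_zero, add_assoc, Nat.reduceAdd,
    valid_some_SE (hh.sub even_two),
    numPeaks_congr (p := some SE) (p' := none) (by simp) (by simp),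
    peakWeight_congr (x + 2) (p := some SE) (p' := none) (by simp) (by simp)]
  constructor
  · rintro ⟨⟨-, -, H⟩, h2⟩
    exact ⟨H, h2⟩
  · rintro ⟨H, h3⟩
    exact ⟨⟨⟨by omega, by omega, by simp, by simp, by simp, fun _ _ => ⟨he, fun h => by omega⟩⟩,
      ⟨by omega, by omega, by simp, by simp, by simp, by simp⟩, H⟩, h3⟩

/-- Two `E` steps in front of a nonempty path. The empty path is kept, as a path may not end with
an `E` step. -/
def consEastEast (L : List PathStep) : List PathStep :=
  if L = [] then [] else E :: E :: L

theorem consEastEast_injective : Function.Injective consEastEast := by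
  intro L L' h
  unfold consEastEast at h
  split_ifs at h with h1 h2 h2
  · rw [h1, h2]
  · simpa using h

theorem consEastEast_mem_runs {k : ℕ} (e x N m : ℕ) (L : List PathStep) :
    consEastEast L ∈ runs k none 0 e x N m ↔ L ∈ runs k none 0 (e + 2) (x + 2) N m := by
  unfold consEastEast
  split_ifs with h
  · subst h
    simp only [runs, Set.mem_ofPred_eq, Valid, numPeaks, peakWeight]
    refine and_congr_left fun _ => ⟨fun H => ?_, fun H => ?_⟩ <;>
      exact ⟨H.nonneg, H.le, fun _ => by simp, by simp, by simp, by simp⟩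
  · simp only [runs, Set.mem_ofPred_eq, Valid, numPeaks, peakWeight, rise, reduceCtorEq, false_and,
      Option.some.injEq, if_false, if_true, zero_add, add_zero, add_assoc, Nat.reduceAdd,
      valid_some_E (e + 2) h,
      numPeaks_congr (p := some E) (p' := none) (by simp) (by simp),
      peakWeight_congr (x + 2) (p := some E) (p' := none) (by simp) (by simp)]
    constructor
    · rintro ⟨⟨-, -, H⟩, h2⟩
      exact ⟨H, h2⟩
    · rintro ⟨H, h2⟩
      exact ⟨⟨⟨by simp, by simp, by simp, by simp, by simp, by simp⟩,
        ⟨by simp, by simp, by simp, by simp, by simp, by simp⟩, H⟩, h2⟩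

theorem Valid.two_steps_of_pos {k : ℕ} {p : Option PathStep} {h : ℤ} {e : ℕ} {L : List PathStep}
    (H : Valid k p h e L) (hh : Even h) (h0 : h ≠ 0) :
    (∃ L', L = NE :: NE :: L') ∨ (∃ L', L = NE :: SE :: L') ∨ ∃ L', L = SE :: SE :: L' := by
  have hn := H.nonneg
  have hh2 := Int.even_iff.1 hh
  match L, H with
  | [], H => exact absurd (LocalRule.terminal H rfl).1 h0
  | E :: _, H => exact absurd (H.1.east rfl) h0
  | NE :: NE :: L', _ => exact Or.inl ⟨L', rfl⟩
  | NE :: SE :: L', _ => exact Or.inr (Or.inl ⟨L', rfl⟩)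
  | NE :: E :: _, H =>
    have := H.2.1.east rfl
    simp only [rise] at this
    omega
  | [NE], H =>
    have := (LocalRule.terminal H.2 rfl).2
    simp at this
  | SE :: SE :: L', _ => exact Or.inr (Or.inr ⟨L', rfl⟩)
  | SE :: NE :: _, H =>
    have := Int.even_iff.1 (H.2.1.valley rfl rfl)
    simp only [rise] at this
    omega
  | SE :: E :: _, H =>
    have := H.2.1.east rfl
    simp only [rise] at this
    omega
  | [SE], H =>
    have := (LocalRule.terminal H.2 rfl).1
    simp only [rise] at this
    omega

theorem Valid.two_steps_of_zero {k : ℕ} {e : ℕ} {L : List PathStep}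
    (H : Valid k none 0 e L) (he : Even e) :
    (∃ L', L = NE :: NE :: L') ∨ (∃ L', L = NE :: SE :: L') ∨ ∃ L', L = consEastEast L' := by
  have he2 := Nat.even_iff.1 he
  match L, H with
  | [], _ => exact Or.inr (Or.inr ⟨[], rfl⟩)
  | NE :: NE :: L', _ => exact Or.inl ⟨L', rfl⟩
  | NE :: SE :: L', _ => exact Or.inr (Or.inl ⟨L', rfl⟩)
  | NE :: E :: _, H =>
    have := H.2.1.east rfl
    simp [rise] at this
  | [NE], H =>
    have := (LocalRule.terminal H.2 rfl).2
    simp at this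
  | SE :: _, H =>
    have := H.2.nonneg
    simp [rise] at this
  | [E], H =>
    have := (LocalRule.terminal H.2 rfl).2
    simp at this
  | E :: SE :: _, H =>
    have := H.2.2.nonneg
    simp [rise] at this
  | E :: NE :: _, H =>
    have := Nat.even_iff.1 (H.2.2.of_NE (by simp [rise])).1
    simp at this
    omega
  | E :: E :: L', H =>
    have : L' ≠ [] := by
      rintro rfl
      have := (LocalRule.terminal H.2.2 rfl).2
      simp at this
    exact Or.inr (Or.inr ⟨L', by simp [consEastEast, this]⟩)

end LatticePath

/-! ### The path count satisfies the relations of the multisum -/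

namespace LatticePath

open PathStep Multisum PowerSeries

/-- The coefficient of `z ^ N` after the substitution `z ↦ q ^ x z`, which accounts for moving the
starting point of a path from abscissa `0` to abscissa `x`. -/
noncomputable def shiftedCoeff (x N : ℕ) (f : ℤ⟦X⟧⟦X⟧) : ℤ⟦X⟧ :=
  (X : ℤ⟦X⟧) ^ (x * N) * coeff N f

theorem shiftedCoeff_add (x N : ℕ) (f g : ℤ⟦X⟧⟦X⟧) :
    shiftedCoeff x N (f + g) = shiftedCoeff x N f + shiftedCoeff x N g := by
  simp [shiftedCoeff, mul_add]

theorem shiftedCoeff_shift (x N : ℕ) (f : ℤ⟦X⟧⟦X⟧) :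
    shiftedCoeff x N (shift f) = shiftedCoeff (x + 2) N f := by
  rw [shiftedCoeff, shiftedCoeff, coeff_shift]
  ring

theorem shiftedCoeff_zero_X_mul (x : ℕ) (f : ℤ⟦X⟧⟦X⟧) : shiftedCoeff x 0 (X * f) = 0 := by
  simp [shiftedCoeff]

theorem shiftedCoeff_succ_X_mul (x N : ℕ) (f : ℤ⟦X⟧⟦X⟧) :
    shiftedCoeff x (N + 1) (X * f) = X ^ x * shiftedCoeff x N f := by
  rw [shiftedCoeff, shiftedCoeff, coeff_succ_X_mul]
  ring

theorem shiftedCoeff_C_mul (x N : ℕ) (c : ℤ⟦X⟧) (f : ℤ⟦X⟧⟦X⟧) :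
    shiftedCoeff x N (C c * f) = c * shiftedCoeff x N f := by
  rw [shiftedCoeff, shiftedCoeff, coeff_C_mul]
  ring

theorem coeff_shiftedCoeff_of_lt {x N m : ℕ} (f : ℤ⟦X⟧⟦X⟧) (h : m < x * N) :
    coeff m (shiftedCoeff x N f) = 0 := by
  rw [shiftedCoeff, coeff_X_pow_mul', if_neg (by omega)]

/-- Attaching a peak of weight `c` to the paths counted by `F` multiplies `F` by `q ^ c`. -/
theorem hasCard_weight_add {k : ℕ} {h : ℤ} {e x N c m : ℕ} {F : ℤ⟦X⟧}
    (H : ∀ m' ≤ m, HasCard (runs k none h e x N m') (coeff m' F)) :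
    HasCard {L | Valid k none h e L ∧ 1 + numPeaks none L = N + 1 ∧ c + peakWeight x none L = m}
      (coeff m (X ^ c * F)) := by
  rw [coeff_X_pow_mul']
  split_ifs with hc
  · convert H (m - c) (by omega) using 1
    ext L
    simp only [runs, Set.mem_ofPred_eq]
    refine and_congr_right fun _ => and_congr ?_ ?_ <;> omega
  · refine hasCard_of_isEmpty fun L hL => ?_
    have := hL.2.2
    omega

/-- Without peaks, the only path is the direct descent to the axis. -/
theorem hasCard_runs_zero {k : ℕ} (hk : 2 ≤ k) {j e J : ℕ} (hj : j ≤ k) (x m : ℕ) :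
    HasCard (runs k none j e x 0 m) (coeff m (shiftedCoeff x 0 (pathSeries k J))) := by
  rw [shiftedCoeff, mul_zero, pow_zero, one_mul, coeff_zero_pathSeries hk, coeff_one]
  split_ifs with hm
  · have : runs k none j e x 0 m = {List.replicate j SE} := by
      ext L
      rw [Set.mem_singleton_iff]
      constructor
      · rintro ⟨H, h0, -⟩
        simpa using H.eq_replicate (by simp) h0
      · rintro rfl
        have h0 := numPeaks_replicate (p := none) j (by simp)
        exact ⟨valid_replicate hj (Or.inl rfl), h0, by rw [peakWeight_eq_zero x h0, hm]⟩
    rw [this]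
    exact ⟨Set.finite_singleton _, by simp⟩
  · refine hasCard_of_isEmpty ?_
    rintro L ⟨-, h0, h1⟩
    rw [peakWeight_eq_zero x h0] at h1
    exact hm h1.symm

theorem hasCard_runs_of_lt {k : ℕ} {p : Option PathStep} {h : ℤ} {e x N m : ℕ} (f : ℤ⟦X⟧⟦X⟧)
    (hm : m < x * N) : HasCard (runs k p h e x N m) (coeff m (shiftedCoeff x N f)) := by
  rw [coeff_shiftedCoeff_of_lt f hm]
  refine hasCard_of_isEmpty ?_
  rintro L ⟨-, rfl, h1⟩
  have := mul_numPeaks_le_peakWeight x p L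
  omega

theorem hasCard_runs_NE_zero {k : ℕ} (hk : 2 ≤ k) {h : ℤ} (hh : 1 ≤ h) {e J : ℕ} (x m : ℕ) :
    HasCard (runs k (some NE) h e x 0 m) (coeff m (shiftedCoeff x 0 (upSeries k J))) := by
  have : shiftedCoeff x 0 (upSeries k J) = 0 := by
    rw [shiftedCoeff, upSeries, sub_mul, one_mul, map_sub, map_sub, coeff_shift,
      coeff_zero_pathSeries hk, coeff_zero_pathSeries hk]
    simp
  rw [this, map_zero]
  refine hasCard_of_isEmpty ?_
  rintro L ⟨H, h0, -⟩
  have := (H.of_NE hh).2.2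
  omega

/-- The contribution of the paths that start at height `2 J` with two `NE` steps. -/
noncomputable def doubleRiseSeries (k J : ℕ) : ℤ⟦X⟧⟦X⟧ :=
  if 2 * J + 2 ≤ k then shift (upSeries k (J + 1)) else 0

/-- The contribution of the paths that start at height `2 J` with a peak of height `2 J + 1`. -/
noncomputable def oddPeakSeries (k J : ℕ) : ℤ⟦X⟧⟦X⟧ :=
  if 2 * J + 1 ≤ k then C (X : ℤ⟦X⟧) * (X * shift (pathSeries k J)) else 0

theorem pathSeries_eq {k J : ℕ} (hk : 2 ≤ k) (hJ : 2 * J ≤ k) :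
    pathSeries k J = doubleRiseSeries k J + oddPeakSeries k J
      + shift (pathSeries k (if J = 0 then 1 else J - 1)) := by
  unfold doubleRiseSeries oddPeakSeries
  rcases Nat.lt_or_ge (2 * J + 1) k with h | h
  · rw [if_pos (by omega), if_pos (by omega), ← mul_assoc]
    exact pathSeries_eq_of_lt (by omega)
  · have hJ0 : J ≠ 0 := by omega
    rw [if_neg (by omega), zero_add, if_neg hJ0]
    rcases Nat.eq_or_lt_of_le h with h | h
    · rw [if_pos (by omega), ← mul_assoc]
      exact pathSeries_eq_of_odd h.symm hJ0
    · rw [if_neg (by omega), zero_add]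
      exact pathSeries_eq_of_even (by omega) hJ0

theorem upSeries_eq {k J : ℕ} (hk : 2 ≤ k) (hJ : 2 * J ≤ k) (hJ0 : J ≠ 0) :
    upSeries k J = doubleRiseSeries k J + oddPeakSeries k J
      + X * shift (pathSeries k (J - 1)) := by
  have := pathSeries_eq hk hJ
  rw [if_neg hJ0] at this
  rw [upSeries]
  linear_combination this

/-- At a vertex of height `2 j` preceded by `e` east steps, with `e` even, the number of possible
continuations is governed by the series with index `j` if `4 ∣ e` and `j + 1` otherwise. -/
theorem hasCard_runs {k : ℕ} (hk : 2 ≤ k) (d : ℕ) : ∀ {x N m j e : ℕ}, m < x + d → Even e →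
    2 * (j + e % 4 / 2) ≤ k →
    HasCard (runs k none (2 * j : ℕ) e x N m)
        (coeff m (shiftedCoeff x N (pathSeries k (j + e % 4 / 2)))) ∧
      (j ≠ 0 → HasCard (runs k (some NE) (2 * j : ℕ) e x N m)
        (coeff m (shiftedCoeff x N (upSeries k (j + e % 4 / 2))))) := by
  -- Removing two steps increases `x` by `2` and does not increase `m`; once `m < x`, no peaks remain.
  induction d with
  | zero =>
    intro x N m j e hm he hJ
    rcases Nat.eq_zero_or_pos N with rfl | hN
    · exact ⟨hasCard_runs_zero hk (by omega) x m,
        fun hj => hasCard_runs_NE_zero hk (by omega) x m⟩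
    · have : m < x * N := lt_of_lt_of_le hm (Nat.le_mul_of_pos_right x hN)
      exact ⟨hasCard_runs_of_lt _ this, fun _ => hasCard_runs_of_lt _ this⟩
  | succ d ih =>
    intro x N m j e hm he hJ
    have he2 := Nat.even_iff.1 he
    have hev : Even ((2 * j : ℕ) : ℤ) := by simp
    have h0 : (0 : ℤ) ≤ (2 * j : ℕ) := by omega
    have hNN : ∀ p, p = none ∨ p = some NE →
        HasCard {L | NE :: NE :: L ∈ runs k p (2 * j : ℕ) e x N m}
          (coeff m (shiftedCoeff x N (doubleRiseSeries k (j + e % 4 / 2)))) := by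
      intro p hp
      simp only [NE_NE_mem_runs hp h0]
      unfold doubleRiseSeries
      split_ifs with hJ2
      · rw [shiftedCoeff_shift]
        have := (ih (x := x + 2) (N := N) (m := m) (j := j + 1) (e := e) (by omega) he
          (by omega)).2 (by omega)
        rw [show j + 1 + e % 4 / 2 = j + e % 4 / 2 + 1 by omega] at this
        rw [show ((2 * j : ℕ) : ℤ) + 2 = (2 * (j + 1) : ℕ) by omega]
        exact this
      · have : shiftedCoeff x N (0 : ℤ⟦X⟧⟦X⟧) = 0 := by simp [shiftedCoeff]
        rw [this, map_zero]
        refine hasCard_of_isEmpty ?_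
        rintro L ⟨H, -⟩
        have h1 := H.le
        have h2 := (H.of_NE (by omega)).2.1
        omega
    have hNS : ∀ p, p = none ∨ p = some NE →
        HasCard {L | NE :: SE :: L ∈ runs k p (2 * j : ℕ) e x N m}
          (coeff m (shiftedCoeff x N (oddPeakSeries k (j + e % 4 / 2)))) := by
      intro p hp
      simp only [NE_SE_mem_runs hp h0 hev he]
      unfold oddPeakSeries
      split_ifs with hJ1
      · rw [shiftedCoeff_C_mul]
        cases N with
        | zero =>
          rw [shiftedCoeff_zero_X_mul, mul_zero, map_zero]
          refine hasCard_of_isEmpty ?_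
          rintro L ⟨-, -, h, -⟩
          omega
        | succ N =>
          rw [shiftedCoeff_succ_X_mul, shiftedCoeff_shift, ← mul_assoc, ← pow_succ']
          have := hasCard_weight_add (k := k) (h := (2 * j : ℕ)) (e := e) (x := x + 2) (N := N)
            (c := x + 1) (m := m) fun m' hm' =>
              (ih (x := x + 2) (N := N) (m := m') (j := j) (e := e) (by omega) he hJ).1
          convert this using 3
          exact and_iff_right (by omega)
      · have : shiftedCoeff x N (0 : ℤ⟦X⟧⟦X⟧) = 0 := by simp [shiftedCoeff]
        rw [this, map_zero]
        refine hasCard_of_isEmpty ?_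
        rintro L ⟨h, -⟩
        omega
    have hinj : Function.Injective fun L : List PathStep => SE :: SE :: L :=
      fun L L' h => by simpa using h
    constructor
    · rw [pathSeries_eq hk hJ, shiftedCoeff_add, shiftedCoeff_add, map_add, map_add,
        shiftedCoeff_shift]
      rcases Nat.eq_zero_or_pos j with rfl | hj
      · refine HasCard.of_two_steps consEastEast_injective ?_
          (fun L hL => Valid.two_steps_of_zero (by simpa using hL.1) he)
          (hNN none (Or.inl rfl)) (hNS none (Or.inl rfl)) ?_
        · intro L L'
          unfold consEastEast
          split_ifs <;> simp
        · have := (ih (x := x + 2) (N := N) (m := m) (j := 0) (e := e + 2) (by omega)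
            (he.add even_two) (by omega)).1
          simp only [mul_zero, Nat.cast_zero, consEastEast_mem_runs]
          rw [show (if 0 + e % 4 / 2 = 0 then 1 else 0 + e % 4 / 2 - 1) = 0 + (e + 2) % 4 / 2 by
            split_ifs <;> omega]
          exact this
      · refine HasCard.of_two_steps hinj (by simp)
          (fun L hL => hL.1.two_steps_of_pos hev (by omega))
          (hNN none (Or.inl rfl)) (hNS none (Or.inl rfl)) ?_
        simp only [SE_SE_mem_runs_none (k := k) (show (2 : ℤ) ≤ (2 * j : ℕ) by omega) (by omega) hev]
        have := (ih (x := x + 2) (N := N) (m := m) (j := j - 1) (e := e) (by omega) he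
          (by omega)).1
        rw [if_neg (by omega), show j + e % 4 / 2 - 1 = j - 1 + e % 4 / 2 by omega]
        rw [show ((2 * j : ℕ) : ℤ) - 2 = (2 * (j - 1) : ℕ) by omega]
        exact this
    · intro hj
      rw [upSeries_eq hk hJ (by omega), shiftedCoeff_add, shiftedCoeff_add, map_add, map_add]
      refine HasCard.of_two_steps hinj (by simp)
        (fun L hL => hL.1.two_steps_of_pos hev (by omega))
        (hNN _ (Or.inr rfl)) (hNS _ (Or.inr rfl)) ?_
      simp only [SE_SE_mem_runs_NE (k := k) (show (2 : ℤ) ≤ (2 * j : ℕ) by omega) hev he (by omega)]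
      cases N with
      | zero =>
        rw [shiftedCoeff_zero_X_mul, map_zero]
        refine hasCard_of_isEmpty ?_
        rintro L ⟨-, h, -⟩
        omega
      | succ N =>
        rw [shiftedCoeff_succ_X_mul, shiftedCoeff_shift,
          show ((2 * j : ℕ) : ℤ) - 2 = (2 * (j - 1) : ℕ) by omega,
          show j + e % 4 / 2 - 1 = j - 1 + e % 4 / 2 by omega]
        exact hasCard_weight_add fun m' hm' =>
          (ih (x := x + 2) (N := N) (m := m') (j := j - 1) (e := e) (by omega) he (by omega)).1

theorem numPeaks_le_peakWeight_zero (L : List PathStep) :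
    numPeaks none L ≤ peakWeight 0 none L := by
  cases L with
  | nil => simp [numPeaks]
  | cons c L =>
    have := mul_numPeaks_le_peakWeight 1 (some c) L
    simpa [numPeaks, peakWeight] using this

theorem hasCard_iUnion {m : ℕ} {S : ℕ → Set (List PathStep)} {c : ℕ → ℤ}
    (h : ∀ N, HasCard (S N) (c N)) (hd : ∀ N N' L, L ∈ S N → L ∈ S N' → N = N') :
    HasCard {L | ∃ N < m, L ∈ S N} (∑ N ∈ Finset.range m, c N) := by
  induction m with
  | zero =>
    rw [Finset.sum_range_zero]
    exact hasCard_of_isEmpty fun L ⟨N, hN, _⟩ => by omega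
  | succ m ih =>
    rw [Finset.sum_range_succ]
    convert ih.union (h m) ?_ using 1
    · ext L
      constructor
      · rintro ⟨N, hN, hL⟩
        rcases Nat.eq_or_lt_of_le (Nat.le_of_lt_succ hN) with rfl | hN
        · exact Or.inr hL
        · exact Or.inl ⟨N, hN, hL⟩
      · rintro (⟨N, hN, hL⟩ | hL)
        · exact ⟨N, by omega, hL⟩
        · exact ⟨m, by omega, hL⟩
    · rw [Set.disjoint_left]
      rintro L ⟨N, hN, hL⟩ hL'
      have := hd _ _ _ hL hL'
      omega

theorem hasCard_admissiblePaths {k a : ℕ} (ha : 1 ≤ a) (hak : a ≤ k) (hpar : ¬ k ≡ a [MOD 2])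
    (m : ℕ) : HasCard (admissiblePaths k a m)
      (∑ N ∈ Finset.range (m + 1), coeff m (coeff N (series k a))) := by
  rw [Nat.ModEq] at hpar
  have hs : Even (k + 1 - a) := Nat.even_iff.2 (by omega)
  obtain ⟨j, hj⟩ := hs.exists_two_nsmul
  rw [smul_eq_mul] at hj
  have hcard := hasCard_iUnion (m := m + 1) (fun N => (hasCard_runs (k := k) (by omega) (m + 1)
    (x := 0) (N := N) (m := m) (j := j) (e := 0) (by omega) Even.zero (by omega)).1) ?_
  · convert hcard using 1
    · ext L
      have hiff : L ∈ admissiblePaths k a m ↔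
          Valid k none (2 * j : ℕ) 0 L ∧ peakWeight 0 none L = m := by
        rw [← hj, valid_iff, ← majorIndex_eq_peakWeight]
        constructor
        · rintro ⟨h1, h2, h3, h4, h5⟩
          exact ⟨⟨h1, h2, (h1.hasEvenValleys_iff hs h2).2 ⟨h3, h4⟩⟩, h5⟩
        · rintro ⟨⟨h1, h2, h3⟩, h5⟩
          obtain ⟨h3, h4⟩ := (h1.hasEvenValleys_iff hs h2).1 h3
          exact ⟨h1, h2, h3, h4, h5⟩
      rw [hiff]
      constructor
      · rintro ⟨h1, h2⟩
        have := numPeaks_le_peakWeight_zero L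
        exact ⟨numPeaks none L, by omega, h1, rfl, h2⟩
      · rintro ⟨N, -, h1, -, h2⟩
        exact ⟨h1, h2⟩
    · refine Finset.sum_congr rfl fun N _ => ?_
      rw [shiftedCoeff, zero_mul, pow_zero, one_mul, pathSeries,
        show k + 1 - 2 * (j + 0 % 4 / 2) = a by omega]
  · rintro N N' L ⟨-, rfl, -⟩ ⟨-, rfl, -⟩
    rfl

end LatticePath

namespace Multisum

open PowerSeries

theorem coeff_summand_eq_zero {k a : ℕ} {n : Fin k → ℕ} {m : ℕ} (h : m < ∑ i, n i) :
    coeff m (summand (k + 1) a n) = 0 := by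
  have hle : ∑ i, n i ≤ expo (k + 1) a n := by
    cases k with
    | zero => simp
    | succ k =>
      have h1 : partialSum (k + 2) n 1 ^ 2 ≤
          ∑ j ∈ Finset.Icc 1 (k + 2 - 1), partialSum (k + 2) n j ^ 2 :=
        Finset.single_le_sum (f := fun j => partialSum (k + 2) n j ^ 2) (fun _ _ => by positivity)
          (Finset.mem_Icc.2 ⟨le_rfl, by omega⟩)
      rw [partialSum_one (k + 1)] at h1
      exact (Nat.le_self_pow two_ne_zero _).trans (h1.trans (Nat.le_add_right _ _))
  rw [summand, mul_assoc, coeff_X_pow_mul', if_neg (by omega)]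

theorem hasSum_coeff_summand (k a m : ℕ) :
    HasSum (fun n : Fin k → ℕ => coeff m (summand (k + 1) a n))
      (∑ N ∈ Finset.range (m + 1), coeff m (coeff N (series (k + 1) a))) := by
  have : ∑ N ∈ Finset.range (m + 1), coeff m (coeff N (series (k + 1) a)) =
      ∑ n ∈ (Finset.range (m + 1)).biUnion (Finset.Nat.antidiagonalTuple k),
        coeff m (summand (k + 1) a n) := by
    rw [Finset.sum_biUnion]
    · simp only [coeff_series, map_sum]
    · intro N _ N' _ hN
      refine Finset.disjoint_left.2 fun n hn hn' => hN ?_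
      rw [Finset.Nat.mem_antidiagonalTuple] at hn hn'
      rw [← hn, ← hn']
  rw [this]
  refine hasSum_sum_of_ne_finset_zero fun n hn => coeff_summand_eq_zero ?_
  by_contra! hcon
  exact hn (Finset.mem_biUnion.2 ⟨∑ i, n i, by simpa [Nat.lt_succ_iff] using hcon,
    Finset.Nat.mem_antidiagonalTuple.2 rfl⟩)

end Multisum

/-- The generating function of `S_{k,a}(n)` is the multisum. Each `S_{k,a}(n)` counts a finite set, and
the multisum converges to the generating function in `ℤ⟦X⟧` coefficientwise (`ℤ` being discrete). -/
theorem theorem1p6 (k a : ℕ) (ha : 1 ≤ a) (hak : a ≤ k) (hpar : ¬ k ≡ a [MOD 2]) :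
    (∀ m : ℕ, (LatticePath.admissiblePaths k a m).Finite) ∧
      HasSum (fun n : Fin (k - 1) → ℕ => Multisum.summand k a n)
        (PowerSeries.mk fun m : ℕ => (LatticePath.numPaths k a m : ℤ)) := by
  have hcard := LatticePath.hasCard_admissiblePaths ha hak hpar
  refine ⟨fun m => (hcard m).1, ?_⟩
  rw [PowerSeries.WithPiTopology.hasSum_iff_hasSum_coeff]
  intro m
  rw [PowerSeries.coeff_mk, LatticePath.numPaths, (hcard m).2]
  obtain ⟨k, rfl⟩ : ∃ k', k = k' + 1 := ⟨k - 1, by omega⟩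
  exact Multisum.hasSum_coeff_summand k a m
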